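/- Notation. Let $d \ge 1$. For $z = (x,\omega) \in \mathbb{R}^{2d}$ let $\pi(z)\psi(t) = e^{2\pi i \omega\cdot t}\psi(t-x)$ on $L^2(\mathbb{R}^d)$, let $P\psi(t) = \psi(-t)$, and write $\check{A} = PAP$ for a bounded operator $A$. Put $V_g\psi(z) = \langle \psi, \pi(z)g\rangle = \int_{\mathbb{R}^d} \psi(t)\overline{g(t-x)}e^{-2\pi i\omega\cdot t}\,dt$ and $(\psi\otimes\phi)\xi = \langle \xi,\phi\rangle\psi$. For $f \in L^1(\mathbb{R}^{2d})$ and trace-class operators $S, T$ on $L^2(\mathbb{R}^d)$ let $$f \star S = \int_{\mathbb{R}^{2d}} f(z)\,\pi(z)S\pi(z)^*\,dz,\qquad (T\star S)(z) = \operatorname{tr}\big(T\pi(z)\check{S}\pi(z)^*\big),\qquad Q_S(\psi) = (\psi\otimes\psi)\star\check{S},$$ and for $g \in L^2(\mathbb{R}^d)$ let $A_f^g\psi = \int_{\mathbb{R}^{2d}} f(z)V_g\psi(z)\,\pi(z)g\,dz$ (Bochner integrals). The variation of a real-valued $f\in L^1(\mathbb{R}^{2d})$ is $$\operatorname{Var}(f)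 = \sup\Big\{\int_{\mathbb{R}^{2d}} f\operatorname{div}\phi\,dz : \phi\in C^1_c(\mathbb{R}^{2d},\mathbb{R}^{2d}),\ \|\phi\|_\infty\le 1\Big\},$$ where $\|\phi\|_\infty = \sup_z |\phi(z)|$ with the Euclidean norm. Theorem. Let $f \in L^1(\mathbb{R}^{2d})$ be real-valued with $\operatorname{Var}(f)<\infty$. (1) Let $S, T$ be positive trace-class operators on $L^2(\mathbb{R}^d)$ with $\operatorname{tr}(S)=\operatorname{tr}(T)=1$, and let $f\star S = \sum_{m=1}^\infty \lambda_m (h_m\otimes h_m)$ with $(h_m)_m$ orthonormal in $L^2(\mathbb{R}^d)$ and $\lambda_m$ real. Then $S\star\check{T}$ is a non-negative function, the convolution $f * (S\star\check{T})$ exists at every point, and for every $z\in\mathbb{R}^{2d}$ $$\sum_{m=1}^\infty \lambda_m Q_T(h_m)(z) = f * (S\star\check{T})(z),$$ the series being unconditionally convergent. Moreover, for every $N \ge 0$, $$\Big\| \sum_{m=1}^N \lambda_m Q_T(h_m) - f\Big\|_{L^1} \le \operatorname{Var}(f)\int_{\mathbb{R}^{2d}} |z|\,(S\star\check{T})(z)\,dz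 + \sum_{m=N+1}^\infty |\lambda_m|.$$ (2) Let $g,\varphi\in L^2(\mathbb{R}^d)$ with $\|g\|_{L^2}=\|\varphi\|_{L^2}=1$, and let $A_f^g = \sum_{m=1}^\infty \lambda_m (h_m\otimes h_m)$ with $(h_m)_m$ orthonormal and $\lambda_m$ real. Then for every $N\ge 0$, $$\Big\| \sum_{m=1}^N \lambda_m |V_\varphi h_m|^2 - f\Big\|_{L^1} \le \operatorname{Var}(f)\int_{\mathbb{R}^{2d}} |z|\,|V_\varphi g(z)|^2\,dz + \sum_{m=N+1}^\infty |\lambda_m|.$$ (The right-hand sides are elements of $[0,\infty]$, with $0\cdot\infty = 0$.) -/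

import Mathlib

open MeasureTheory
open scoped ENNReal Convolution ComplexConjugate ComplexOrder

noncomputable section

namespace LocOp

/-! ### Phase space and signals -/

/-- Configuration space `ℝ^d` with the Euclidean norm and Lebesgue measure. -/
abbrev Conf (d : ℕ) : Type := EuclideanSpace ℝ (Fin d)

/-- Phase space `ℝ^{2d}` with the Euclidean norm and Lebesgue measure; the first `d` coordinates
of a point `z = (x, ω)` are time, the last `d` coordinates are frequency. -/
abbrev Phase (d : ℕ) : Type := EuclideanSpace ℝ (Fin d ⊕ Fin d)

/-- The time component `x` of `z = (x, ω)`. -/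
def time {d : ℕ} (z : Phase d) : Conf d := WithLp.toLp 2 fun i => z (Sum.inl i)

/-- The frequency component `ω` of `z = (x, ω)`. -/
def freq {d : ℕ} (z : Phase d) : Conf d := WithLp.toLp 2 fun i => z (Sum.inr i)

/-- The Hilbert space `L²(ℝ^d)` of complex-valued signals. -/
abbrev Signal (d : ℕ) : Type := Lp ℂ 2 (volume : Measure (Conf d))

/-! ### Time-frequency shifts, parity and the short-time Fourier transform -/

/-- The unimodular factor `e^{2πi ω·t}`. -/
def character {d : ℕ} (w t : Conf d) : ℂ :=
  Complex.exp (2 * Real.pi * Complex.I * (inner ℝ w t : ℝ))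

theorem norm_character {d : ℕ} (w t : Conf d) : ‖character w t‖ = 1 := by
  have h : (2 * Real.pi * Complex.I * (inner ℝ w t : ℝ) : ℂ)
      = ((2 * Real.pi * inner ℝ w t : ℝ) : ℂ) * Complex.I := by
    push_cast; ring
  rw [character, h, Complex.norm_exp_ofReal_mul_I]

theorem continuous_character {d : ℕ} (w : Conf d) : Continuous (character w) := by
  unfold character
  fun_prop

/-- The function `t ↦ e^{2πi ω·t} ψ(t - x)`. -/
def shiftFun {d : ℕ} (z : Phase d) (ψ : Conf d → ℂ) : Conf d → ℂ :=
  fun t => character (freq z) t * ψ (t - time z)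

theorem measurePreserving_sub {d : ℕ} (x : Conf d) :
    MeasurePreserving (fun t : Conf d => t - x) volume volume :=
  measurePreserving_sub_right volume x

theorem aestronglyMeasurable_shiftFun {d : ℕ} (z : Phase d) {ψ : Conf d → ℂ}
    (h : AEStronglyMeasurable ψ volume) : AEStronglyMeasurable (shiftFun z ψ) volume :=
  (continuous_character (freq z)).aestronglyMeasurable.mul
    (h.comp_measurePreserving (measurePreserving_sub (time z)))

theorem eLpNorm_shiftFun {d : ℕ} (z : Phase d) {ψ : Conf d → ℂ}
    (h : AEStronglyMeasurable ψ volume) :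
    eLpNorm (shiftFun z ψ) 2 volume = eLpNorm ψ 2 volume := by
  rw [← eLpNorm_comp_measurePreserving h (measurePreserving_sub (time z))]
  refine eLpNorm_congr_norm_ae (Filter.Eventually.of_forall fun t => ?_)
  simp [shiftFun, norm_character]

theorem memLp_shiftFun {d : ℕ} (z : Phase d) {ψ : Conf d → ℂ} (h : MemLp ψ 2 volume) :
    MemLp (shiftFun z ψ) 2 volume :=
  ⟨aestronglyMeasurable_shiftFun z h.1, by rw [eLpNorm_shiftFun z h.1]; exact h.2⟩

theorem shiftFun_congr_ae {d : ℕ} (z : Phase d) {ψ φ : Conf d → ℂ} (h : ψ =ᵐ[volume] φ) :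
    shiftFun z ψ =ᵐ[volume] shiftFun z φ := by
  filter_upwards [(measurePreserving_sub (time z)).quasiMeasurePreserving.ae h] with t ht
  simp [shiftFun, ht]

/-- The time-frequency shift `π(z) ψ(t) = e^{2πi ω·t} ψ(t - x)`, `z = (x, ω)`, as an isometry of
`L²(ℝ^d)`. -/
def tfShiftIsometry {d : ℕ} (z : Phase d) : Signal d →ₗᵢ[ℂ] Signal d where
  toFun ψ := (memLp_shiftFun z (Lp.memLp ψ)).toLp (shiftFun z ψ)
  map_add' ψ φ := by
    rw [← MemLp.toLp_add, MemLp.toLp_eq_toLp_iff]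
    filter_upwards [shiftFun_congr_ae z (Lp.coeFn_add ψ φ)] with t ht
    rw [ht]
    simp [shiftFun, mul_add]
  map_smul' c ψ := by
    rw [RingHom.id_apply, ← MemLp.toLp_const_smul, MemLp.toLp_eq_toLp_iff]
    filter_upwards [shiftFun_congr_ae z (Lp.coeFn_smul c ψ)] with t ht
    rw [ht]
    simp only [shiftFun, Pi.smul_apply, smul_eq_mul]
    ring
  norm_map' ψ := by
    change ‖(memLp_shiftFun z (Lp.memLp ψ)).toLp (shiftFun z ψ)‖ = ‖ψ‖
    rw [Lp.norm_toLp, eLpNorm_shiftFun z (Lp.memLp ψ).1, Lp.norm_def]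

/-- The time-frequency shift `π(z)` as a bounded operator on `L²(ℝ^d)`. -/
def tfShift {d : ℕ} (z : Phase d) : Signal d →L[ℂ] Signal d :=
  (tfShiftIsometry z).toContinuousLinearMap

/-- The parity operator `P ψ(t) = ψ(-t)` on `L²(ℝ^d)`. -/
def parity (d : ℕ) : Signal d →L[ℂ] Signal d :=
  (Lp.compMeasurePreservingₗᵢ ℂ (fun t : Conf d => -t)
    (Measure.measurePreserving_neg volume)).toContinuousLinearMap

/-- `Ǎ = P A P`. -/
def check {d : ℕ} (A : Signal d →L[ℂ] Signal d) : Signal d →L[ℂ] Signal d :=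
  parity d ∘L A ∘L parity d

/-- The short-time Fourier transform
`V_g ψ(x, ω) = ∫ ψ(t) conj(g(t - x)) e^{-2πi ω·t} dt`. -/
def stft {d : ℕ} (g ψ : Signal d) (z : Phase d) : ℂ :=
  ∫ t, ψ t * conj (g (t - time z)) * character (-freq z) t

/-- The localization operator `A_f^g ψ = ∫ f(z) V_g ψ(z) π(z) g dz`
(a Bochner integral in `L²(ℝ^d)`). -/
def locOp {d : ℕ} (f : Phase d → ℝ) (g : Signal d) (ψ : Signal d) : Signal d :=
  ∫ z, ((f z : ℂ) * stft g ψ z) • tfShift z g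

/-! ### Trace-class operators -/

section Trace

variable {H : Type*} [NormedAddCommGroup H] [InnerProductSpace ℂ H] [CompleteSpace H]

/-- `A` is trace class: `tr |A| = ∑ ⟨|A| e_i, e_i⟩ < ∞` in orthonormal bases `(e_i)`, where
`|A| = √(A* A)`. -/
def IsTraceClass (A : H →L[ℂ] H) : Prop :=
  ∀ (w : Set H) (b : HilbertBasis w ℂ H),
    Summable fun i => RCLike.re (inner ℂ (b i) (CFC.abs A (b i)))

/-- The index set of an orthonormal basis of `H`. -/
def basisSet (H : Type*) [NormedAddCommGroup H] [InnerProductSpace ℂ H] [CompleteSpace H] :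
    Set H :=
  (exists_hilbertBasis ℂ H).choose

/-- An orthonormal basis of `H`. -/
def someBasis (H : Type*) [NormedAddCommGroup H] [InnerProductSpace ℂ H] [CompleteSpace H] :
    HilbertBasis (basisSet H) ℂ H :=
  (exists_hilbertBasis ℂ H).choose_spec.choose

/-- The trace `tr A = ∑ ⟨A e_i, e_i⟩`; for trace-class `A` it does not depend on the orthonormal
basis. (Mathlib's inner product is linear in the second argument.) -/
def opTrace (A : H →L[ℂ] H) : ℂ :=
  ∑' i, inner ℂ (someBasis H i) (A (someBasis H i))

/-- `A = ∑_m λ_m (h_m ⊗ h_m)` with `(h_m)` orthonormal and `λ_m` real, where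
`(h ⊗ h) ψ = ⟨ψ, h⟩ h`; the series is only required to converge strongly, which for compact `A`
amounts to convergence in norm. -/
def IsSpectralDecomp (A : H → H) (lam : ℕ → ℝ) (h : ℕ → H) : Prop :=
  Orthonormal ℂ h ∧
    ∀ ψ : H, HasSum (fun m => (lam m : ℂ) • InnerProductSpace.rankOne ℂ (h m) (h m) ψ) (A ψ)

end Trace

/-! ### Convolutions of quantum harmonic analysis -/

/-- The function-operator convolution `f ⋆ S = ∫ f(z) π(z) S π(z)* dz` (a Bochner integral). -/
def funOpConv {d : ℕ} (f : Phase d → ℝ) (S : Signal d →L[ℂ] Signal d) :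
    Signal d →L[ℂ] Signal d :=
  ∫ z, (f z : ℂ) • (tfShift z ∘L S ∘L ContinuousLinearMap.adjoint (tfShift z))

/-- The operator-operator convolution `(T ⋆ S)(z) = tr (T π(z) Š π(z)*)`. -/
def opOpConv {d : ℕ} (T S : Signal d →L[ℂ] Signal d) (z : Phase d) : ℂ :=
  opTrace (T ∘L tfShift z ∘L check S ∘L ContinuousLinearMap.adjoint (tfShift z))

/-- Cohen's class distribution `Q_S(ψ) = (ψ ⊗ ψ) ⋆ Š`. -/
def cohen {d : ℕ} (S : Signal d →L[ℂ] Signal d) (ψ : Signal d) (z : Phase d) : ℂ :=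
  opOpConv (InnerProductSpace.rankOne ℂ ψ ψ) (check S) z

/-! ### Variation -/

/-- The divergence `∑ ∂_i φ_i` of a vector field. -/
def divergence {d : ℕ} (φ : Phase d → Phase d) (z : Phase d) : ℝ :=
  ∑ i, fderiv ℝ φ z (EuclideanSpace.single i 1) i

/-- `Var(f) = sup {∫ f div φ : φ ∈ C¹_c(ℝ^{2d}, ℝ^{2d}), ‖φ‖_∞ ≤ 1}`, an element of `[0, ∞]`
(the supremum is over a set that contains `0`, so truncating negative values is harmless). -/
def variation {d : ℕ} (f : Phase d → ℝ) : ℝ≥0∞ :=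
  ⨆ φ : {φ : Phase d → Phase d //
      ContDiff ℝ 1 φ ∧ HasCompactSupport φ ∧ ∀ z, ‖φ z‖ ≤ 1},
    ENNReal.ofReal (∫ z, f z * divergence φ.1 z)

end LocOp

end

/-! Expand `S = ∑ u_i ⊗ u_i` and `T = ∑ v_j ⊗ v_j` with `∑ ‖u_i‖² = ∑ ‖v_j‖² = 1`. Then `Q_T(ψ)(z) =
∑_j |⟨π(z) v_j, ψ⟩|²` (`energy`), and `S ⋆ Ť` is the kernel `K(z) = ∑_{i,j} |⟨π(z) v_j, u_i⟩|²`
(`blurKernel`): continuous, between 0 and 1, and of integral one by Moyal's identity.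

For the series, compute `⟨w, A w⟩` at `w = π(z) v_j` twice. The spectral decomposition gives `∑_m
λ_m |⟨w, h_m⟩|²`; the definition of `A` gives `∫ f(y) energy u w y dy`. Summing over `j` yields `∑_m
λ_m Q_T(h_m)(z) = (f * K)(z)`, because time-frequency shifts compose up to a phase
(`hasSum_eigenvalue_mul_energy`). Only the quadratic form of `A` enters, so `f ⋆ S` and `A_f^g`
share one argument.

The error is `(f * K - f)` minus the tail of the series. Each `Q_T(h_m)` has integral one, so the
tail costs at most `∑ |λ_m|`. As `K` is a probability density, `f * K - f` is controlled by
averaging `‖f(· - y) - f‖₁ ≤ |y| Var(f)` against `K` (`lintegral_enorm_translate_sub_le`). That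
bound is dual: differentiate `t ↦ ∫ f(z) g(z + t y) dz` for test functions `g`. -/

noncomputable section

namespace LocOp

/-! ### Plancherel's theorem on `L¹ ∩ L²` -/

open FourierTransform SchwartzMap in
/-- Plancherel's theorem for functions in `L¹ ∩ L²`. -/
theorem lintegral_enorm_sq_fourier {E : Type*} [NormedAddCommGroup E] [InnerProductSpace ℝ E]
    [FiniteDimensional ℝ E] [MeasurableSpace E] [BorelSpace E] {F : E → ℂ}
    (h1 : Integrable F volume) (h2 : MemLp F 2 volume) :
    ∫⁻ w, ‖𝓕 F w‖ₑ ^ 2 = ∫⁻ t, ‖F t‖ₑ ^ 2 := by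
  have hcont : Continuous (𝓕 F) :=
    VectorFourier.fourierIntegral_continuous Real.continuous_fourierChar
      (by exact continuous_inner) h1
  set G : Lp ℂ 2 (volume : Measure E) := 𝓕 (h2.toLp F) with hG
  have hae : (G : E → ℂ) =ᵐ[volume] 𝓕 F := by
    -- The `L²` transform and the Fourier integral agree against every test function: both pairings
    -- equal the pairing of `F` with the transformed test function.
    refine ae_eq_of_integral_contDiff_smul_eq ?_ hcont.locallyIntegrable ?_
    · exact (Lp.memLp G).locallyIntegrable (by norm_num)
    intro g g_smooth g_cpt
    have hg₁ : HasCompactSupport (Complex.ofRealCLM ∘ g) := g_cpt.comp_left rfl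
    have hg₂ : ContDiff ℝ ((⊤ : ℕ∞) : WithTop ℕ∞) (Complex.ofRealCLM ∘ g) :=
      Complex.ofRealCLM.contDiff.comp g_smooth
    set φ : 𝓢(E, ℂ) := hg₁.toSchwartzMap hg₂ with hφ
    have e1 : ∫ x, g x • G x = (Lp.toTemperedDistribution G) φ := by
      rw [Lp.toTemperedDistribution_apply]; simp [hφ]
    have e2 : (Lp.toTemperedDistribution G) φ = ∫ x, (𝓕 φ) x • F x := by
      rw [hG, ← Lp.fourier_toTemperedDistribution_eq, TemperedDistribution.fourier_apply,
        Lp.toTemperedDistribution_apply]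
      refine integral_congr_ae ?_
      filter_upwards [h2.coeFn_toLp] with x hx
      rw [hx]
    have e3 : ∫ x, (𝓕 φ) x • F x = ∫ x, φ x • (𝓕 F) x := by
      rw [fourier_coe]
      have := VectorFourier.integral_fourierIntegral_smul_eq_flip (L := innerₗ E) (μ := volume)
        (ν := volume) (f := φ) (g := F) Real.continuous_fourierChar
        (by exact continuous_inner) φ.integrable h1
      rw [flip_innerₗ] at this
      exact this
    rw [e1, e2, e3]
    simp [hφ]
  have hn : eLpNorm G 2 volume = eLpNorm (h2.toLp F) 2 volume := by
    have : ‖G‖ = ‖h2.toLp F‖ := Lp.norm_fourier_eq _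
    rw [Lp.norm_def, Lp.norm_def] at this
    exact (ENNReal.toReal_eq_toReal_iff' (Lp.eLpNorm_ne_top _) (Lp.eLpNorm_ne_top _)).1 this
  rw [eLpNorm_congr_ae hae, eLpNorm_congr_ae h2.coeFn_toLp] at hn
  have key : ∀ u : E → ℂ, ∫⁻ w, ‖u w‖ₑ ^ 2 = (eLpNorm u 2 volume) ^ 2 := by
    intro u
    have := eLpNorm_nnreal_pow_eq_lintegral (μ := (volume : Measure E)) (f := u) (p := 2)
      (by norm_num)
    simpa using this.symm
  rw [key, key, hn]

/-! ### Bounded variation and translations in `L¹` -/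

theorem abs_sub_le_sq_div_sqrt {k δ : ℝ} (hδ : 0 < δ) :
    |k| - δ ≤ k * (k / √(k ^ 2 + δ ^ 2)) := by
  have hpos : 0 < k ^ 2 + δ ^ 2 := by positivity
  have hs : 0 < √(k ^ 2 + δ ^ 2) := Real.sqrt_pos.2 hpos
  have hle : √(k ^ 2 + δ ^ 2) ≤ |k| + δ := by
    rw [Real.sqrt_le_left (by positivity)]
    nlinarith [sq_abs k, abs_nonneg k]
  rw [← mul_div_assoc, le_div_iff₀ hs]
  rcases le_total (|k|) δ with h | h
  · nlinarith [mul_self_nonneg k]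
  · nlinarith [sq_abs k, abs_nonneg k]

/-- The `L¹` norm is the supremum of the pairings with smooth compactly supported functions
bounded by one. -/
theorem integral_abs_le_of_forall_contDiff {E : Type*} [NormedAddCommGroup E] [NormedSpace ℝ E]
    [FiniteDimensional ℝ E] [MeasurableSpace E] [BorelSpace E] {μ : Measure E}
    [IsFiniteMeasureOnCompacts μ] {u : E → ℝ} (hu : Integrable u μ) {M : ℝ}
    (hM : ∀ g : E → ℝ, ContDiff ℝ 1 g → HasCompactSupport g → (∀ x, |g x| ≤ 1) →
      ∫ x, u x * g x ∂μ ≤ M) :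
    ∫ x, |u x| ∂μ ≤ M := by
  refine le_of_forall_pos_le_add fun ε hε => ?_
  have hε3 : 0 < ε / 3 := by positivity
  obtain ⟨k, hkc, hks, hk⟩ := (memLp_one_iff_integrable.2 hu).exist_eLpNorm_sub_le
    ENNReal.one_ne_top le_rfl hε3
  have hki : Integrable k μ := hks.continuous.integrable_of_hasCompactSupport hkc
  have hsub : ∫ x, |u x - k x| ∂μ ≤ ε / 3 := by
    rw [eLpNorm_one_eq_lintegral_enorm] at hk
    have h := ofReal_integral_norm_eq_lintegral_enorm (hu.sub hki)
    simp only [Pi.sub_apply, Real.norm_eq_abs] at h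
    simp only [Pi.sub_apply] at hk
    rw [← h] at hk
    exact (ENNReal.ofReal_le_ofReal_iff hε3.le).1 hk
  set K := tsupport k with hK
  have hKf : μ K < ∞ := hkc.isCompact.measure_lt_top
  obtain ⟨δ, hδ, hδK⟩ : ∃ δ : ℝ, 0 < δ ∧ δ * μ.real K ≤ ε / 3 := by
    -- The `+ 1` covers the case where `K` has measure zero.
    refine ⟨ε / 3 / (μ.real K + 1), by positivity, ?_⟩
    rw [div_mul_eq_mul_div, div_le_iff₀ (by positivity)]
    nlinarith [measureReal_nonneg (μ := μ) (s := K)]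
  -- A smooth substitute for the sign of `k`, with the same support; it loses at most `δ`, and only
  -- on `K`.
  set g : E → ℝ := fun x => k x / √(k x ^ 2 + δ ^ 2) with hg
  have hpos : ∀ x, 0 < k x ^ 2 + δ ^ 2 := fun x => by positivity
  have hgs : ContDiff ℝ 1 g := by
    have hk1 : ContDiff ℝ 1 k := hks.of_le (by norm_cast)
    exact hk1.div (((hk1.pow 2).add contDiff_const).sqrt fun x => (hpos x).ne')
      fun x => (Real.sqrt_pos.2 (hpos x)).ne'
  have hgc : HasCompactSupport g := by
    refine hkc.mono fun x hx => ?_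
    simp only [hg, Function.mem_support] at hx ⊢
    intro h; simp [h] at hx
  have hg1 : ∀ x, |g x| ≤ 1 := fun x => by
    simp only [hg, abs_div, abs_of_pos (Real.sqrt_pos.2 (hpos x))]
    rw [div_le_one (Real.sqrt_pos.2 (hpos x))]
    exact Real.abs_le_sqrt (by nlinarith)
  have hugi : Integrable (fun x => u x * g x) μ := hu.mul_bdd
    hgs.continuous.aestronglyMeasurable (Filter.Eventually.of_forall hg1)
  have hind : Integrable (K.indicator fun _ => δ) μ :=
    (integrable_indicator_iff (isClosed_tsupport k).measurableSet).2
      (integrableOn_const hKf.ne)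
  -- Exchanging `u` and `k` twice costs `2ε/3` after integration; the smoothed sign costs the last
  -- `ε/3`.
  have hpt : ∀ x, |u x| ≤ u x * g x + 2 * |u x - k x| + K.indicator (fun _ => δ) x := by
    intro x
    have h1 : |k x| ≤ k x * g x + K.indicator (fun _ => δ) x := by
      by_cases hx : x ∈ K
      · rw [Set.indicator_of_mem hx]
        have := abs_sub_le_sq_div_sqrt (k := k x) hδ
        simp only [hg]; linarith
      · rw [Set.indicator_of_notMem hx]
        simp [image_eq_zero_of_notMem_tsupport hx]
    have h2 : (k x - u x) * g x ≤ |u x - k x| := by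
      rw [abs_sub_comm]
      calc (k x - u x) * g x ≤ |(k x - u x) * g x| := le_abs_self _
        _ = |k x - u x| * |g x| := abs_mul _ _
        _ ≤ |k x - u x| * 1 := by gcongr; exact hg1 x
        _ = _ := mul_one _
    have h3 : |u x| ≤ |u x - k x| + |k x| := by
      simpa using abs_add_le (u x - k x) (k x)
    linarith
  have hdi : Integrable (fun x => |u x - k x|) μ := (hu.sub hki).abs
  calc ∫ x, |u x| ∂μ
      ≤ ∫ x, (u x * g x + 2 * |u x - k x| + K.indicator (fun _ => δ) x) ∂μ :=
        integral_mono hu.abs ((hugi.add (hdi.const_mul 2)).add hind) hpt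
    _ = ∫ x, u x * g x ∂μ + 2 * ∫ x, |u x - k x| ∂μ + δ * μ.real K := by
        rw [integral_add (f := fun x => u x * g x + 2 * |u x - k x|)
          (hugi.add (hdi.const_mul 2)) hind, integral_add hugi (hdi.const_mul 2),
          integral_const_mul, integral_indicator (isClosed_tsupport k).measurableSet]
        simp [mul_comm, hK]
    _ ≤ M + ε := by
        have := hM g hgs hgc hg1
        linarith

theorem divergence_smul_const {d : ℕ} {g : Phase d → ℝ} {z : Phase d}
    (hg : DifferentiableAt ℝ g z) (e : Phase d) :
    divergence (fun z => g z • e) z = fderiv ℝ g z e := by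
  have h : ∀ v, fderiv ℝ (fun z => g z • e) z v = fderiv ℝ g z v • e := fun v => by
    rw [fderiv_smul_const hg]; simp
  simp only [divergence, h]
  conv_rhs => rw [← (EuclideanSpace.basisFun (Fin d ⊕ Fin d) ℝ).sum_repr e]
  simp [map_sum, mul_comm]

theorem integral_mul_divergence_le {d : ℕ} {f : Phase d → ℝ} (hvar : variation f < ∞)
    {φ : Phase d → Phase d} (h1 : ContDiff ℝ 1 φ) (h2 : HasCompactSupport φ)
    (h3 : ∀ z, ‖φ z‖ ≤ 1) : ∫ z, f z * divergence φ z ≤ (variation f).toReal := by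
  rw [← ENNReal.ofReal_le_iff_le_toReal hvar.ne]
  exact le_iSup (fun φ : {φ : Phase d → Phase d //
      ContDiff ℝ 1 φ ∧ HasCompactSupport φ ∧ ∀ z, ‖φ z‖ ≤ 1} =>
    ENNReal.ofReal (∫ z, f z * divergence φ.1 z)) ⟨φ, h1, h2, h3⟩

/-- The field `g · y/‖y‖` is admissible in the variation, and its divergence is the derivative of
`g` along `y/‖y‖`. -/
theorem integral_mul_fderiv_le {d : ℕ} {f : Phase d → ℝ} (hvar : variation f < ∞)
    {g : Phase d → ℝ} (hg : ContDiff ℝ 1 g) (hc : HasCompactSupport g) (h1 : ∀ z, |g z| ≤ 1)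
    (y : Phase d) : ∫ z, f z * fderiv ℝ g z y ≤ ‖y‖ * (variation f).toReal := by
  rcases eq_or_ne y 0 with rfl | hy
  · simp
  have hy' : ‖y‖ ≠ 0 := norm_ne_zero_iff.2 hy
  have h := integral_mul_divergence_le hvar (φ := fun z => g z • (‖y‖⁻¹ • y))
    (hg.smul contDiff_const) hc.smul_right (fun z => by
      rw [norm_smul, norm_smul, norm_inv, norm_norm, inv_mul_cancel₀ hy', mul_one]
      exact h1 z)
  simp only [divergence_smul_const (hg.differentiable one_ne_zero _), map_smul, smul_eq_mul] at h
  have e : ∀ z, f z * fderiv ℝ g z y = ‖y‖ * (f z * (‖y‖⁻¹ * fderiv ℝ g z y)) := fun z => by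
    field_simp
  simp_rw [e]
  rw [integral_const_mul]
  gcongr

/-- Mean value inequality on `[0, 1]` for `t ↦ ∫ f(z) g(z + t y) dz`: its derivative is bounded by
`integral_mul_fderiv_le` applied to a translate of `g`. -/
theorem integral_mul_translate_sub_le {d : ℕ} {f : Phase d → ℝ} (hf : Integrable f volume)
    (hvar : variation f < ∞) {g : Phase d → ℝ} (hg : ContDiff ℝ 1 g) (hc : HasCompactSupport g)
    (h1 : ∀ z, |g z| ≤ 1) (y : Phase d) :
    (∫ z, f z * g (z + y)) - ∫ z, f z * g z ≤ ‖y‖ * (variation f).toReal := by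
  obtain ⟨C, hC⟩ := (hc.fderiv (𝕜 := ℝ)).exists_bound_of_continuous
    (hg.continuous_fderiv one_ne_zero)
  have hmeas : ∀ t : ℝ, AEStronglyMeasurable (fun z => f z * g (z + t • y)) volume := fun t =>
    hf.1.mul (hg.continuous.comp (by fun_prop)).aestronglyMeasurable
  have hint : ∀ t : ℝ, Integrable (fun z => f z * g (z + t • y)) volume := fun t =>
    hf.mul_bdd (hg.continuous.comp (by fun_prop)).aestronglyMeasurable
      (Filter.Eventually.of_forall fun z => h1 _)
  have hder : ∀ t : ℝ, HasDerivAt (fun t : ℝ => ∫ z, f z * g (z + t • y))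
      (∫ z, f z * fderiv ℝ g (z + t • y) y) t := fun t => by
    refine (hasDerivAt_integral_of_dominated_loc_of_deriv_le (μ := volume)
      (F := fun t z => f z * g (z + t • y)) (F' := fun t z => f z * fderiv ℝ g (z + t • y) y)
      (bound := fun z => |f z| * (C * ‖y‖)) (s := Set.univ) Filter.univ_mem
      (Filter.Eventually.of_forall hmeas) (hint t) ?_ ?_ ?_ ?_).2
    · exact hf.1.mul (Continuous.aestronglyMeasurable
        (((hg.continuous_fderiv one_ne_zero).comp (by fun_prop)).clm_apply continuous_const))
    · refine Filter.Eventually.of_forall fun z t _ => ?_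
      rw [norm_mul, Real.norm_eq_abs]
      gcongr
      exact ((fderiv ℝ g _).le_opNorm y).trans (by gcongr; exact hC _)
    · exact hf.abs.mul_const _
    · refine Filter.Eventually.of_forall fun z t _ => ?_
      have hd : HasDerivAt (fun t : ℝ => z + t • y) y t := by
        simpa using ((hasDerivAt_id t).smul_const y).const_add z
      exact ((hg.differentiable one_ne_zero _).hasFDerivAt.comp_hasDerivAt t hd).const_mul (f z)
  have hle := image_sub_le_mul_sub_of_deriv_le (f := fun t : ℝ => ∫ z, f z * g (z + t • y))
    (fun t => (hder t).differentiableAt) (C := ‖y‖ * (variation f).toReal) (fun t => by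
      rw [(hder t).deriv]
      have := integral_mul_fderiv_le hvar (g := fun z => g (z + t • y))
        (hg.comp (contDiff_id.add contDiff_const))
        (hc.comp_homeomorph (Homeomorph.addRight (t • y))) (fun z => h1 _) y
      simpa only [fderiv_comp_add_right] using this) zero_le_one
  simpa [add_comm] using hle

/-- Translations move a function of bounded variation in `L¹` at most by the variation times
the length of the translation. -/
theorem lintegral_enorm_translate_sub_le {d : ℕ} {f : Phase d → ℝ} (hf : Integrable f volume)
    (hvar : variation f < ∞) (y : Phase d) :
    ∫⁻ z, ‖f (z - y) - f z‖ₑ ≤ ‖y‖ₑ * variation f := by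
  have hi : Integrable (fun z => f (z - y) - f z) volume := (hf.comp_sub_right y).sub hf
  have h := integral_abs_le_of_forall_contDiff hi (M := ‖y‖ * (variation f).toReal)
    fun g hg hc h1 => by
      have hb : ∀ u : Phase d → ℝ, Integrable u volume → Integrable (fun z => u z * g z) volume :=
        fun u hu => hu.mul_bdd hg.continuous.aestronglyMeasurable (Filter.Eventually.of_forall h1)
      -- The translation moves from `f`, which need not be differentiable, to the test function.
      have e := integral_sub_right_eq_self (μ := volume) (fun z => f z * g (z + y)) y
      simp only [sub_add_cancel] at e
      simp only [sub_mul]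
      rw [integral_sub (hb _ (hf.comp_sub_right y)) (hb _ hf), e]
      exact integral_mul_translate_sub_le hf hvar hg hc h1 y
  rw [← ofReal_integral_norm_eq_lintegral_enorm hi]
  refine (ENNReal.ofReal_le_ofReal h).trans_eq ?_
  rw [ENNReal.ofReal_mul (norm_nonneg _), ofReal_norm, ENNReal.ofReal_toReal hvar.ne]

/-! ### Time-frequency shifts and Moyal's identity -/

variable {d : ℕ}

/-- The point `(x, ω)` of phase space. -/
def phasePoint (x w : Conf d) : Phase d := WithLp.toLp 2 (Sum.elim x w)

@[simp] theorem time_phasePoint (x w : Conf d) : time (phasePoint x w) = x := rfl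

@[simp] theorem freq_phasePoint (x w : Conf d) : freq (phasePoint x w) = w := rfl

theorem phasePoint_time_freq (z : Phase d) : phasePoint (time z) (freq z) = z := by
  ext i; rcases i with i | i <;> rfl

theorem continuous_time : Continuous (time : Phase d → Conf d) := by
  unfold time; fun_prop

theorem continuous_freq : Continuous (freq : Phase d → Conf d) := by
  unfold freq; fun_prop

theorem continuous_phasePoint : Continuous fun p : Conf d × Conf d => phasePoint p.1 p.2 := by
  refine (PiLp.continuous_toLp 2 _).comp (continuous_pi fun i => ?_)
  rcases i with i | i <;> simp only [Sum.elim_inl, Sum.elim_inr] <;> fun_prop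

theorem time_sub (z y : Phase d) : time (z - y) = time z - time y := rfl

theorem freq_sub (z y : Phase d) : freq (z - y) = freq z - freq y := rfl

theorem measurePreserving_time_freq :
    MeasurePreserving (fun z : Phase d => (time z, freq z)) volume (volume.prod volume) := by
  have h := (((PiLp.volume_preserving_toLp (Fin d)).prod (PiLp.volume_preserving_toLp (Fin d))).comp
    ((measurePreserving_sumPiEquivProdPi (fun _ : Fin d ⊕ Fin d => (volume : Measure ℝ))).comp
      (PiLp.volume_preserving_ofLp (Fin d ⊕ Fin d))))
  exact h

theorem conj_character (w t : Conf d) : conj (character w t) = character (-w) t := by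
  rw [character, character, ← Complex.exp_conj]
  simp [Complex.conj_ofReal, map_ofNat]

theorem character_add (w w' t : Conf d) :
    character (w + w') t = character w t * character w' t := by
  rw [character, character, character, ← Complex.exp_add, inner_add_left]
  push_cast; ring_nf

theorem character_add_right (w t t' : Conf d) :
    character w (t + t') = character w t * character w t' := by
  rw [character, character, character, ← Complex.exp_add, inner_add_right]
  push_cast; ring_nf

theorem continuous_character_left (t : Conf d) : Continuous fun w : Conf d => character w t := by
  unfold character
  fun_prop

theorem coeFn_tfShift (z : Phase d) (ψ : Signal d) : tfShift z ψ =ᵐ[volume] shiftFun z ψ :=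
  (memLp_shiftFun z (Lp.memLp ψ)).coeFn_toLp

@[simp] theorem norm_tfShift (z : Phase d) (ψ : Signal d) : ‖tfShift z ψ‖ = ‖ψ‖ :=
  (tfShiftIsometry z).norm_map ψ

@[simp] theorem inner_tfShift_tfShift (z : Phase d) (ψ φ : Signal d) :
    inner ℂ (tfShift z ψ) (tfShift z φ) = inner ℂ ψ φ :=
  (tfShiftIsometry z).inner_map_map ψ φ

/-- The short-time Fourier transform as a matrix coefficient of the time-frequency shifts. -/
theorem inner_tfShift_left (g ψ : Signal d) (z : Phase d) :
    inner ℂ (tfShift z g) ψ = stft g ψ z := by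
  rw [L2.inner_def, stft]
  refine integral_congr_ae ?_
  filter_upwards [coeFn_tfShift z g] with t ht
  rw [ht, RCLike.inner_apply, shiftFun, map_mul, conj_character]
  ring

theorem norm_inner_tfShift_le (g ψ : Signal d) (z : Phase d) :
    ‖inner ℂ (tfShift z g) ψ‖ ≤ ‖g‖ * ‖ψ‖ :=
  (norm_inner_le_norm _ _).trans_eq (by rw [norm_tfShift])

/-- Covariance of the time-frequency shifts up to a phase. -/
theorem tfShift_eq_smul_comp (z y : Phase d) (v : Signal d) :
    tfShift z v = conj (character (freq (z - y)) (-time y)) • tfShift y (tfShift (z - y) v) := by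
  refine Lp.ext ?_
  filter_upwards [coeFn_tfShift z v, coeFn_tfShift y (tfShift (z - y) v),
    shiftFun_congr_ae y (coeFn_tfShift (z - y) v),
    Lp.coeFn_smul (conj (character (freq (z - y)) (-time y))) (tfShift y (tfShift (z - y) v))]
    with t h1 h2 h3 h4
  rw [h4, Pi.smul_apply, h1, h2, h3, smul_eq_mul]
  have hc : conj (character (freq (z - y)) (-time y)) * character (freq (z - y)) (-time y) = 1 := by
    rw [Complex.conj_mul', norm_character]; simp
  have hz : character (freq z) t = character (freq y) t * character (freq (z - y)) t := by
    rw [← character_add, freq_sub, add_sub_cancel]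
  simp only [shiftFun]
  rw [hz, sub_eq_add_neg t (time y), character_add_right]
  have ht : t + -time y - time (z - y) = t - time z := by rw [time_sub]; abel
  rw [ht]
  linear_combination (-(character (freq y) t * character (freq (z - y)) t * v (t - time z))) * hc

/-- The phase of `tfShift_eq_smul_comp` has modulus one, so only `z - y` matters; this is what
produces a convolution. -/
theorem norm_inner_tfShift_tfShift (z y : Phase d) (v u : Signal d) :
    ‖inner ℂ (tfShift z v) (tfShift y u)‖ = ‖inner ℂ (tfShift (z - y) v) u‖ := by
  rw [tfShift_eq_smul_comp z y, inner_smul_left, inner_tfShift_tfShift, norm_mul,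
    RCLike.norm_conj, RCLike.norm_conj, norm_character, one_mul]

/-- Weak continuity comes from dominated convergence. Since the norms are constant, expanding the
squared norm of a difference upgrades it to strong continuity. -/
theorem continuous_modulation (ψ : Signal d) :
    Continuous fun w : Conf d => tfShift (phasePoint 0 w) ψ := by
  have hweak : ∀ φ : Signal d, Continuous fun w : Conf d =>
      inner ℂ (tfShift (phasePoint 0 w) ψ) φ := fun φ => by
    have hi : Integrable (fun t => φ t * conj (ψ t)) volume := by
      have := L2.integrable_inner (𝕜 := ℂ) ψ φ
      simpa [RCLike.inner_apply, mul_comm] using this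
    simp only [inner_tfShift_left, stft, time_phasePoint, freq_phasePoint, sub_zero]
    refine continuous_of_dominated (bound := fun t => ‖φ t * conj (ψ t)‖) (fun w => ?_)
      (fun w => Filter.Eventually.of_forall fun t => ?_) hi.norm
      (Filter.Eventually.of_forall fun t => ?_)
    · exact hi.1.mul (continuous_character _).aestronglyMeasurable
    · rw [norm_mul, norm_character, mul_one]
    · exact continuous_const.mul ((continuous_character_left t).comp continuous_neg)
  refine continuous_iff_continuousAt.2 fun w₀ => ?_
  rw [ContinuousAt, tendsto_iff_norm_sub_tendsto_zero]
  have hsq : Filter.Tendsto (fun w : Conf d =>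
      ‖tfShift (phasePoint 0 w) ψ - tfShift (phasePoint 0 w₀) ψ‖ ^ 2) (nhds w₀) (nhds 0) := by
    simp only [norm_sub_sq (𝕜 := ℂ), norm_tfShift]
    have h := (RCLike.continuous_re.comp (hweak (tfShift (phasePoint 0 w₀) ψ))).tendsto w₀
    have h2 := ((tendsto_const_nhds (x := ‖ψ‖ ^ 2)).sub (h.const_mul 2)).add
      (tendsto_const_nhds (x := ‖ψ‖ ^ 2))
    refine h2.trans_eq ?_
    simp only [Function.comp_apply, inner_tfShift_tfShift, inner_self_eq_norm_sq]
    ring_nf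
  have := hsq.sqrt
  simpa using this

theorem tfShift_eq_modulation_translate (z : Phase d) (ψ : Signal d) :
    tfShift z ψ = tfShift (phasePoint 0 (freq z))
      (Lp.compMeasurePreserving (fun t => t - time z) (measurePreserving_sub (time z)) ψ) := by
  refine Lp.ext ?_
  filter_upwards [coeFn_tfShift z ψ, coeFn_tfShift (phasePoint 0 (freq z))
      (Lp.compMeasurePreserving (fun t => t - time z) (measurePreserving_sub (time z)) ψ),
    Lp.coeFn_compMeasurePreserving ψ (measurePreserving_sub (time z))] with t h1 h2 h3
  rw [h1, h2]
  simp only [shiftFun, freq_phasePoint, time_phasePoint, sub_zero]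
  rw [h3, Function.comp_apply]

/-- Time-frequency shifts are strongly continuous. -/
theorem continuous_tfShift (ψ : Signal d) : Continuous fun z : Phase d => tfShift z ψ := by
  -- Modulations are isometries, hence 1-Lipschitz uniformly in the frequency, so separate
  -- continuity gives joint continuity.
  have hM : Continuous fun p : Conf d × Signal d => tfShift (phasePoint 0 p.1) p.2 :=
    continuous_prod_of_continuous_lipschitzWith' _ 1
      (fun w => (tfShiftIsometry (phasePoint 0 w)).lipschitz) (fun φ => continuous_modulation φ)
  have hT : Continuous fun x : Conf d =>
      Lp.compMeasurePreserving (fun t => t - x) (measurePreserving_sub x) ψ := by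
    let τ : C(Conf d, C(Conf d, Conf d)) :=
      ContinuousMap.curry ⟨fun p : Conf d × Conf d => p.2 - p.1, by fun_prop⟩
    exact Continuous.compMeasurePreservingLp (f := fun _ => ψ) (g := fun x => τ x)
      continuous_const τ.continuous (fun x => measurePreserving_sub x) (by norm_num)
  have h := hM.comp (continuous_freq.prodMk (hT.comp continuous_time))
  refine h.congr fun z => ?_
  exact (tfShift_eq_modulation_translate z ψ).symm

theorem lintegral_enorm_sq (ψ : Signal d) : ∫⁻ t, ‖ψ t‖ₑ ^ 2 = ‖ψ‖ₑ ^ 2 := by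
  have := eLpNorm_nnreal_pow_eq_lintegral (μ := (volume : Measure (Conf d))) (f := ψ) (p := 2)
    (by norm_num)
  rw [Lp.enorm_def]
  simpa using this.symm

/-- Moyal's identity. -/
theorem lintegral_enorm_stft_sq (v ψ : Signal d) :
    ∫⁻ z, ‖stft v ψ z‖ₑ ^ 2 = ‖v‖ₑ ^ 2 * ‖ψ‖ₑ ^ 2 := by
  have hcont : Continuous fun z => stft v ψ z := by
    simp only [← inner_tfShift_left]
    exact (continuous_tfShift v).inner continuous_const
  have hGm : Measurable fun p : Conf d × Conf d => ‖stft v ψ (phasePoint p.1 p.2)‖ₑ ^ 2 :=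
    (hcont.comp continuous_phasePoint).measurable.enorm.pow_const 2
  have hmv : Measurable (v : Conf d → ℂ) := (Lp.stronglyMeasurable v).measurable
  have hmψ : Measurable (ψ : Conf d → ℂ) := (Lp.stronglyMeasurable ψ).measurable
  have hH : Measurable fun p : Conf d × Conf d => ‖ψ p.2‖ₑ ^ 2 * ‖v (p.2 - p.1)‖ₑ ^ 2 :=
    ((hmψ.comp measurable_snd).enorm.pow_const 2).mul
      ((hmv.comp (measurable_snd.sub measurable_fst)).enorm.pow_const 2)
  have htot : ∫⁻ x : Conf d, ∫⁻ t : Conf d, ‖ψ t‖ₑ ^ 2 * ‖v (t - x)‖ₑ ^ 2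
      = ‖v‖ₑ ^ 2 * ‖ψ‖ₑ ^ 2 := by
    rw [lintegral_lintegral_swap hH.aemeasurable]
    have : ∀ t : Conf d, ∫⁻ x : Conf d, ‖ψ t‖ₑ ^ 2 * ‖v (t - x)‖ₑ ^ 2
        = ‖ψ t‖ₑ ^ 2 * ‖v‖ₑ ^ 2 := fun t => by
      rw [lintegral_const_mul _ (by fun_prop),
        lintegral_sub_left_eq_self (fun s => ‖v s‖ₑ ^ 2) t, lintegral_enorm_sq]
    simp only [this]
    rw [lintegral_mul_const _ (by fun_prop), lintegral_enorm_sq, mul_comm]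
  have hfin : ∀ᵐ x : Conf d, ∫⁻ t : Conf d, ‖ψ t‖ₑ ^ 2 * ‖v (t - x)‖ₑ ^ 2 < ∞ := by
    refine ae_lt_top hH.lintegral_prod_right' ?_
    rw [htot]
    exact ENNReal.mul_ne_top (by simp) (by simp)
  calc ∫⁻ z, ‖stft v ψ z‖ₑ ^ 2
      = ∫⁻ z : Phase d, ‖stft v ψ (phasePoint (time z) (freq z))‖ₑ ^ 2 := by
        simp only [phasePoint_time_freq]
    _ = ∫⁻ p, ‖stft v ψ (phasePoint p.1 p.2)‖ₑ ^ 2 ∂(volume.prod volume) :=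
        measurePreserving_time_freq.lintegral_comp hGm
    _ = ∫⁻ x : Conf d, ∫⁻ w : Conf d, ‖stft v ψ (phasePoint x w)‖ₑ ^ 2 :=
        lintegral_prod _ hGm.aemeasurable
    _ = ∫⁻ x : Conf d, ∫⁻ t : Conf d, ‖ψ t‖ₑ ^ 2 * ‖v (t - x)‖ₑ ^ 2 := by
        refine lintegral_congr_ae ?_
        filter_upwards [hfin] with x hx
        -- For fixed `x` the transform in `ω` is the Fourier transform of `F`. Hölder puts `F` in
        -- `L¹` for all `x`; membership in `L²` is what `hfin` supplies almost everywhere.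
        set F : Conf d → ℂ := fun t => ψ t * conj (v (t - x)) with hF
        have hvx : MemLp (fun t => v (t - x)) 2 volume :=
          (Lp.memLp v).comp_measurePreserving (measurePreserving_sub x)
        have hFm : Measurable F := by
          refine hmψ.mul (Complex.continuous_conj.measurable.comp ?_)
          exact hmv.comp (measurable_id.sub_const x)
        have hFn : ∀ t, ‖F t‖ₑ ^ 2 = ‖ψ t‖ₑ ^ 2 * ‖v (t - x)‖ₑ ^ 2 := fun t => by
          simp only [hF, enorm_mul, mul_pow, RCLike.enorm_conj]
        have hF1 : Integrable F volume := (Lp.memLp ψ).integrable_mul hvx.star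
        have hF2 : MemLp F 2 volume := by
          refine ⟨hFm.aestronglyMeasurable, ?_⟩
          rw [eLpNorm_lt_top_iff_lintegral_rpow_enorm_lt_top (by norm_num) (by norm_num)]
          simpa [hFn] using hx
        rw [← lintegral_congr hFn, ← lintegral_enorm_sq_fourier hF1 hF2]
        refine lintegral_congr fun w => ?_
        congr 2
        rw [Real.fourier_eq', stft]
        refine integral_congr_ae (Filter.Eventually.of_forall fun t => ?_)
        simp only [time_phasePoint, freq_phasePoint, hF, character, smul_eq_mul, inner_neg_left]
        rw [mul_comm, real_inner_comm]
        congr 2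
        push_cast; ring
    _ = ‖v‖ₑ ^ 2 * ‖ψ‖ₑ ^ 2 := htot

/-! ### Rank-one expansions and traces -/

section Hilbert

variable {H : Type*} [NormedAddCommGroup H] [InnerProductSpace ℂ H]

theorem hasSum_subtype_of_support_subset {κ E : Type*} [AddCommMonoid E] [TopologicalSpace E]
    {F : κ → E} {a : E} {s : Set κ} (h : HasSum F a) (hs : Function.support F ⊆ s) :
    HasSum (fun i : s => F i) a :=
  (hasSum_subtype_iff_of_support_subset hs).2 h

theorem hasSum_clm_apply {ι : Type*} {F : ι → H →L[ℂ] H} {A : H →L[ℂ] H} (h : HasSum F A)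
    (x : H) : HasSum (fun i => F i x) (A x) :=
  h.mapL (ContinuousLinearMap.apply ℂ H x)

theorem hasSum_inner_right {ι : Type*} {F : ι → H} {a : H} (h : HasSum F a) (x : H) :
    HasSum (fun i => inner ℂ x (F i)) (inner ℂ x a) :=
  h.mapL (innerSL ℂ x)

theorem hasSum_norm_inner_sq {κ : Type*} (b : HilbertBasis κ ℂ H) (x : H) :
    HasSum (fun k => ‖inner ℂ (b k) x‖ ^ 2) (‖x‖ ^ 2) := by
  have h := b.hasSum_inner_mul_inner x x
  have h' : ∀ k, inner ℂ x (b k) * inner ℂ (b k) x = ((‖inner ℂ (b k) x‖ ^ 2 : ℝ) : ℂ) :=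
    fun k => by
      rw [← inner_conj_symm x (b k), Complex.conj_mul']
      push_cast; rfl
  have h0 : inner ℂ x x = ((‖x‖ ^ 2 : ℝ) : ℂ) := by
    rw [inner_self_eq_norm_sq_to_K]; push_cast; rfl
  rw [h0] at h
  simp only [h'] at h
  exact Complex.hasSum_ofReal.1 h

theorem continuous_rankOne_self : Continuous fun x : H => InnerProductSpace.rankOne ℂ x x := by
  refine continuous_iff_continuousAt.2 fun y => ?_
  rw [ContinuousAt, tendsto_iff_norm_sub_tendsto_zero]
  have hlim : Filter.Tendsto (fun x : H => ‖x - y‖ * ‖x‖ + ‖y‖ * ‖x - y‖) (nhds y) (nhds 0) := by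
    have : Continuous fun x : H => ‖x - y‖ * ‖x‖ + ‖y‖ * ‖x - y‖ := by fun_prop
    simpa using this.tendsto y
  refine squeeze_zero (fun _ => norm_nonneg _) (fun x => ?_) hlim
  have h : InnerProductSpace.rankOne ℂ x x - InnerProductSpace.rankOne ℂ y y
      = InnerProductSpace.rankOne ℂ (x - y) x + InnerProductSpace.rankOne ℂ y (x - y) := by
    rw [map_sub, map_sub, sub_apply]
    abel
  rw [h]
  refine (norm_add_le _ _).trans_eq ?_
  rw [InnerProductSpace.norm_rankOne, InnerProductSpace.norm_rankOne]

/-- A summable family has countable support and the discarded terms vanish. Countability is needed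
to exchange sums with integrals. -/
theorem exists_countable_hasSum_rankOne {κ : Type*} {u : κ → H} {S : H →L[ℂ] H} {c : ℝ}
    (hu : HasSum (fun i => ‖u i‖ ^ 2) c)
    (hS : HasSum (fun i => InnerProductSpace.rankOne ℂ (u i) (u i)) S) :
    ∃ (s : Set κ) (u : s → H), Countable s ∧ HasSum (fun i => ‖u i‖ ^ 2) c ∧
      HasSum (fun i => InnerProductSpace.rankOne ℂ (u i) (u i)) S := by
  refine ⟨Function.support fun i => ‖u i‖ ^ 2, fun i => u i,
    hu.summable.countable_support.to_subtype,
    hasSum_subtype_of_support_subset hu subset_rfl, ?_⟩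
  have hsub : (Function.support fun i => InnerProductSpace.rankOne ℂ (u i) (u i)) ⊆
      Function.support fun i => ‖u i‖ ^ 2 := fun i => by
    simp only [Function.mem_support]
    contrapose!
    intro hz
    rw [← norm_eq_zero, InnerProductSpace.norm_rankOne, ← sq, hz]
  have h := hasSum_subtype_of_support_subset hS hsub
  exact h


/-- The double series behind the trace of `(∑ u_i ⊗ u_i) B` converges absolutely. -/
theorem summable_inner_mul_inner {ι κ : Type*} (b : HilbertBasis κ ℂ H) {u : ι → H}
    (hu : Summable fun i => ‖u i‖ ^ 2) (C : H →L[ℂ] H) :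
    Summable fun p : ι × κ => inner ℂ (C (u p.1)) (b p.2) * inner ℂ (b p.2) (u p.1) := by
  -- Majorant from `ab ≤ (a² + b²)/2`; Parseval sums it over `k`.
  set c : ι × κ → ℝ := fun p =>
    (‖inner ℂ (b p.2) (C (u p.1))‖ ^ 2 + ‖inner ℂ (b p.2) (u p.1)‖ ^ 2) / 2
  have hcs : ∀ i, HasSum (fun k => c (i, k)) ((‖C (u i)‖ ^ 2 + ‖u i‖ ^ 2) / 2) := fun i => by
    have h := ((hasSum_norm_inner_sq b (C (u i))).add (hasSum_norm_inner_sq b (u i))).div_const 2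
    simpa only [c] using h
  have hc : Summable c := by
    refine (summable_prod_of_nonneg fun p => by positivity).2 ⟨fun i => (hcs i).summable, ?_⟩
    simp only [fun i => (hcs i).tsum_eq]
    refine Summable.of_nonneg_of_le (fun i => by positivity) (fun i => ?_)
      (hu.mul_left ((‖C‖ ^ 2 + 1) / 2))
    have := pow_le_pow_left₀ (norm_nonneg _) (C.le_opNorm (u i)) 2
    rw [mul_pow] at this
    linarith
  refine Summable.of_norm_bounded hc fun p => ?_
  simp only [c, norm_mul]
  rw [norm_inner_symm]
  nlinarith [sq_nonneg (‖inner ℂ (b p.2) (C (u p.1))‖ - ‖inner ℂ (b p.2) (u p.1)‖)]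

variable [CompleteSpace H]

/-- If `S = R²` with `R` symmetric and `∑ ‖R e_i‖² < ∞`, then `S = ∑ (R e_i) ⊗ (R e_i)`. -/
theorem hasSum_rankOne_of_mul_self {κ : Type*} (b : HilbertBasis κ ℂ H) {R S : H →L[ℂ] H}
    (hsymm : ∀ x y, inner ℂ (R x) y = inner ℂ x (R y)) (hS : ∀ x, S x = R (R x))
    (hsum : Summable fun i => ‖R (b i)‖ ^ 2) :
    HasSum (fun i => InnerProductSpace.rankOne ℂ (R (b i)) (R (b i))) S := by
  have hs : Summable fun i => InnerProductSpace.rankOne ℂ (R (b i)) (R (b i)) := by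
    refine Summable.of_norm (hsum.congr fun i => ?_)
    rw [InnerProductSpace.norm_rankOne, sq]
  -- The series converges absolutely in norm; its limit is identified pointwise by expanding `R x`
  -- in the basis.
  have he : ∑' i, InnerProductSpace.rankOne ℂ (R (b i)) (R (b i)) = S := by
    refine ContinuousLinearMap.ext fun x => ?_
    have h1 := hasSum_clm_apply hs.hasSum x
    have h2 := R.hasSum (b.hasSum_repr (R x))
    have h3 : (fun i => R (b.repr (R x) i • b i))
        = fun i => InnerProductSpace.rankOne ℂ (R (b i)) (R (b i)) x := funext fun i => by
      rw [InnerProductSpace.rankOne_apply, hsymm, map_smul, b.repr_apply_apply]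
    rw [h3] at h2
    rw [hS, h1.unique h2]
  rw [← he]
  exact hs.hasSum

/-- A positive operator of trace one is a norm-convergent countable sum of rank-one operators
`u_i ⊗ u_i` with `∑ ‖u_i‖² = 1`. -/
theorem exists_hasSum_rankOne {S : H →L[ℂ] H} (hS : S.IsPositive) (htr : opTrace S = 1) :
    ∃ (s : Set (basisSet H)) (u : s → H), Countable s ∧ HasSum (fun i => ‖u i‖ ^ 2) 1 ∧
      HasSum (fun i => InnerProductSpace.rankOne ℂ (u i) (u i)) S := by
  obtain ⟨R, hsymm, hS_apply⟩ : ∃ R : H →L[ℂ] H,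
      (∀ x y, inner ℂ (R x) y = inner ℂ x (R y)) ∧ ∀ x, S x = R (R x) := by
    refine ⟨CFC.sqrt S, fun x y => ?_, fun x => ?_⟩
    · exact ((ContinuousLinearMap.nonneg_iff_isPositive _).1 (CFC.sqrt_nonneg S)).isSymmetric x y
    · have h := CFC.sqrt_mul_sqrt_self S ((ContinuousLinearMap.nonneg_iff_isPositive S).2 hS)
      exact (DFunLike.congr_fun h x).symm
  rw [opTrace] at htr
  generalize someBasis H = b at htr
  have hterm : ∀ i, inner ℂ (b i) (S (b i)) = ((‖R (b i)‖ ^ 2 : ℝ) : ℂ) := fun i => by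
    rw [hS_apply, ← hsymm, inner_self_eq_norm_sq_to_K]
    push_cast; rfl
  have hsum : HasSum (fun i => ‖R (b i)‖ ^ 2) 1 := by
    have hs : Summable fun i => inner ℂ (b i) (S (b i)) := by
      -- A non-summable `tsum` is zero by convention, so trace one already forces summability.
      by_contra hns
      exact one_ne_zero (htr.symm.trans (tsum_eq_zero_of_not_summable hns))
    have h := hs.hasSum
    rw [htr] at h
    simp only [hterm] at h
    exact Complex.hasSum_ofReal.1 (by simpa only [Complex.ofReal_one] using h)
  have hop := hasSum_rankOne_of_mul_self b hsymm hS_apply hsum.summable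
  exact exists_countable_hasSum_rankOne hsum hop

/-- The trace of `S B` for `S = ∑ u_i ⊗ u_i`. -/
theorem opTrace_comp_of_hasSum_rankOne {ι : Type*} {u : ι → H} {S : H →L[ℂ] H}
    (hu : Summable fun i => ‖u i‖ ^ 2)
    (hS : HasSum (fun i => InnerProductSpace.rankOne ℂ (u i) (u i)) S) (B : H →L[ℂ] H) :
    opTrace (S ∘L B) = ∑' i, inner ℂ (u i) (B (u i)) := by
  rw [opTrace]
  generalize someBasis H = b
  -- Summed over `i` this gives a diagonal entry of `S B`; summed over `k`, Parseval gives `⟨u_i, B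
  -- u_i⟩`.
  set a : basisSet H → ι → ℂ := fun k i =>
    inner ℂ (ContinuousLinearMap.adjoint B (u i)) (b k) * inner ℂ (b k) (u i) with ha
  have hk : ∀ k, inner ℂ (b k) (S (B (b k))) = ∑' i, a k i := fun k => by
    have h := hasSum_inner_right (hasSum_clm_apply hS (B (b k))) (b k)
    refine h.tsum_eq.symm.trans (tsum_congr fun i => ?_)
    simp only [ha]
    rw [InnerProductSpace.rankOne_apply, inner_smul_right, ContinuousLinearMap.adjoint_inner_left]
  have hi : ∀ i, HasSum (fun k => a k i) (inner ℂ (u i) (B (u i))) := fun i => by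
    rw [← ContinuousLinearMap.adjoint_inner_left]
    exact b.hasSum_inner_mul_inner _ _
  have hsummable : Summable (Function.uncurry a) :=
    (summable_inner_mul_inner b hu (ContinuousLinearMap.adjoint B)).comp_injective
      (i := Prod.swap) Prod.swap_injective
  calc ∑' k, inner ℂ (b k) ((S ∘L B) (b k)) = ∑' k, ∑' i, a k i := tsum_congr hk
    _ = ∑' i, ∑' k, a k i := hsummable.tsum_comm.symm
    _ = _ := tsum_congr fun i => (hi i).tsum_eq

end Hilbert

/-! ### Parity, energies and quadratic forms -/

theorem parity_parity (ψ : Signal d) : parity d (parity d ψ) = ψ := by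
  have hp : ∀ φ : Signal d, parity d φ =ᵐ[volume] fun t => φ (-t) := fun φ =>
    Lp.coeFn_compMeasurePreserving φ (Measure.measurePreserving_neg volume)
  refine Lp.ext ?_
  filter_upwards [hp (parity d ψ),
    (Measure.measurePreserving_neg volume).quasiMeasurePreserving.ae (hp ψ)] with t h1 h2
  rw [h1, h2, neg_neg]

/-- Both `Q_T` and `S ⋆ Ť` pass `Ť` to `⋆`, which conjugates by parity once more; hence `T` itself
remains. -/
theorem check_check (T : Signal d →L[ℂ] Signal d) : check (check T) = T := by
  ext1 ψ
  simp [check, parity_parity]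

/-- The energy `∑_j |⟨π(z) v_j, ψ⟩|²` of the time-frequency shifts of a family. -/
def energy {κ : Type*} (v : κ → Signal d) (ψ : Signal d) (z : Phase d) : ℝ :=
  ∑' j, ‖inner ℂ (tfShift z (v j)) ψ‖ ^ 2

section Energy

variable {κ : Type*} {v : κ → Signal d}

theorem energy_nonneg (ψ : Signal d) (z : Phase d) : 0 ≤ energy v ψ z :=
  tsum_nonneg fun _ => by positivity

theorem norm_sq_inner_tfShift_le (g ψ : Signal d) (z : Phase d) :
    ‖inner ℂ (tfShift z g) ψ‖ ^ 2 ≤ ‖g‖ ^ 2 * ‖ψ‖ ^ 2 := by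
  rw [← mul_pow]
  exact pow_le_pow_left₀ (norm_nonneg _) (norm_inner_tfShift_le _ _ _) 2

theorem hasSum_energy (hv : Summable fun j => ‖v j‖ ^ 2) (ψ : Signal d) (z : Phase d) :
    HasSum (fun j => ‖inner ℂ (tfShift z (v j)) ψ‖ ^ 2) (energy v ψ z) :=
  (Summable.of_nonneg_of_le (fun _ => by positivity)
    (fun j => norm_sq_inner_tfShift_le (v j) ψ z) (hv.mul_right (‖ψ‖ ^ 2))).hasSum

theorem energy_le (hv : HasSum (fun j => ‖v j‖ ^ 2) 1) (ψ : Signal d) (z : Phase d) :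
    energy v ψ z ≤ ‖ψ‖ ^ 2 := by
  have h := hasSum_le (fun j => norm_sq_inner_tfShift_le (v j) ψ z)
    (hasSum_energy hv.summable ψ z) (hv.mul_right (‖ψ‖ ^ 2))
  simpa using h

theorem continuous_energy (hv : Summable fun j => ‖v j‖ ^ 2) (ψ : Signal d) :
    Continuous (energy v ψ) := by
  refine continuous_tsum (fun j => ?_) (hv.mul_right (‖ψ‖ ^ 2)) fun j z => ?_
  · exact (((continuous_tfShift (v j)).inner continuous_const).norm).pow 2
  · rw [Real.norm_of_nonneg (by positivity)]
    exact norm_sq_inner_tfShift_le _ _ _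

/-- Moyal's identity for each `v_j`, then `∑ ‖v_j‖² = 1`. -/
theorem lintegral_energy [Countable κ] (hv : HasSum (fun j => ‖v j‖ ^ 2) 1) (ψ : Signal d) :
    ∫⁻ z, ENNReal.ofReal (energy v ψ z) = ‖ψ‖ₑ ^ 2 := by
  have h1 : ∀ z, ENNReal.ofReal (energy v ψ z) = ∑' j, ‖stft (v j) ψ z‖ₑ ^ 2 := fun z => by
    rw [energy, ENNReal.ofReal_tsum_of_nonneg (fun _ => by positivity)
      (hasSum_energy hv.summable ψ z).summable]
    refine tsum_congr fun j => ?_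
    rw [ENNReal.ofReal_pow (norm_nonneg _), ofReal_norm, inner_tfShift_left]
  simp only [h1]
  rw [lintegral_tsum]
  · simp only [lintegral_enorm_stft_sq]
    rw [ENNReal.tsum_mul_right]
    have : ∀ j, ‖v j‖ₑ ^ 2 = ENNReal.ofReal (‖v j‖ ^ 2) := fun j => by
      rw [ENNReal.ofReal_pow (norm_nonneg _), ofReal_norm]
    simp only [this]
    rw [← ENNReal.ofReal_tsum_of_nonneg (fun _ => by positivity) hv.summable, hv.tsum_eq]
    simp
  · intro j
    simp only [← inner_tfShift_left]
    exact (((continuous_tfShift (v j)).inner continuous_const).measurable.enorm.pow_const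
      2).aemeasurable

/-- Quadratic form of `π(z) T π(z)*` for `T = ∑ v_j ⊗ v_j`. -/
theorem inner_conjugate_eq_energy (hv : Summable fun j => ‖v j‖ ^ 2)
    {T : Signal d →L[ℂ] Signal d}
    (hT : HasSum (fun j => InnerProductSpace.rankOne ℂ (v j) (v j)) T) (ψ : Signal d)
    (z : Phase d) :
    inner ℂ ψ ((tfShift z ∘L T ∘L ContinuousLinearMap.adjoint (tfShift z)) ψ)
      = (energy v ψ z : ℂ) := by
  set y := ContinuousLinearMap.adjoint (tfShift z) ψ with hy
  have h := hasSum_inner_right (hasSum_clm_apply hT y) y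
  have h' : HasSum (fun j => ((‖inner ℂ (tfShift z (v j)) ψ‖ ^ 2 : ℝ) : ℂ)) (inner ℂ y (T y)) := by
    convert h using 2 with j
    rw [InnerProductSpace.rankOne_apply, inner_smul_right, ← inner_conj_symm y (v j), Complex.mul_conj', hy, ContinuousLinearMap.adjoint_inner_right]
    push_cast; rfl
  have he := (hasSum_energy hv ψ z)
  rw [ContinuousLinearMap.comp_apply, ContinuousLinearMap.comp_apply,
    ← ContinuousLinearMap.adjoint_inner_left]
  exact h'.unique (by exact_mod_cast he)

theorem opOpConv_eq_tsum_energy {ι : Type*} {u : ι → Signal d} {S T : Signal d →L[ℂ] Signal d}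
    (hu : Summable fun i => ‖u i‖ ^ 2) (hv : Summable fun j => ‖v j‖ ^ 2)
    (hS : HasSum (fun i => InnerProductSpace.rankOne ℂ (u i) (u i)) S)
    (hT : HasSum (fun j => InnerProductSpace.rankOne ℂ (v j) (v j)) T) (z : Phase d) :
    opOpConv S (check T) z = ((∑' i, energy v (u i) z : ℝ) : ℂ) := by
  rw [opOpConv, check_check, opTrace_comp_of_hasSum_rankOne hu hS, Complex.ofReal_tsum]
  exact tsum_congr fun i => inner_conjugate_eq_energy hv hT (u i) z

theorem cohen_eq_energy (hv : Summable fun j => ‖v j‖ ^ 2) {T : Signal d →L[ℂ] Signal d}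
    (hT : HasSum (fun j => InnerProductSpace.rankOne ℂ (v j) (v j)) T) (ψ : Signal d)
    (z : Phase d) : cohen T ψ z = (energy v ψ z : ℂ) := by
  have h : HasSum (fun _ : Unit => InnerProductSpace.rankOne ℂ ψ ψ)
      (InnerProductSpace.rankOne ℂ ψ ψ) := hasSum_unique _
  rw [cohen, opOpConv_eq_tsum_energy (u := fun _ : Unit => ψ) (hasSum_unique _).summable hv h hT]
  simp

/-- Strong continuity of the shifts alone does not give norm continuity. Each term `π(z) v_j ⊗ π(z)
v_j` is norm continuous, and the series converges uniformly with majorant `‖v_j‖²`. -/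
theorem continuous_conjugate {S : Signal d →L[ℂ] Signal d} (hv : Summable fun j => ‖v j‖ ^ 2)
    (hS : HasSum (fun j => InnerProductSpace.rankOne ℂ (v j) (v j)) S) :
    Continuous fun z : Phase d =>
      tfShift z ∘L S ∘L ContinuousLinearMap.adjoint (tfShift z) := by
  have h : ∀ z : Phase d, tfShift z ∘L S ∘L ContinuousLinearMap.adjoint (tfShift z)
      = ∑' j, InnerProductSpace.rankOne ℂ (tfShift z (v j)) (tfShift z (v j)) := fun z => by
    have h1 := ((ContinuousLinearMap.compL ℂ _ _ _ (tfShift z)).comp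
      ((ContinuousLinearMap.compL ℂ _ _ _).flip
        (ContinuousLinearMap.adjoint (tfShift z)))).hasSum hS
    refine (h1.tsum_eq.symm.trans (tsum_congr fun j => ?_))
    ext1 ψ
    simp [ContinuousLinearMap.adjoint_inner_right]
  simp only [h]
  refine continuous_tsum (fun j => ?_) hv fun j z => ?_
  · exact continuous_rankOne_self.comp (continuous_tfShift (v j))
  · rw [InnerProductSpace.norm_rankOne, norm_tfShift, sq]

/-- Quadratic form of the mixed-state localization operator `f ⋆ S` for `S = ∑ v_j ⊗ v_j`. -/
theorem inner_funOpConv {f : Phase d → ℝ} (hf : Integrable f volume)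
    {S : Signal d →L[ℂ] Signal d} (hv : Summable fun j => ‖v j‖ ^ 2)
    (hS : HasSum (fun j => InnerProductSpace.rankOne ℂ (v j) (v j)) S) (ψ : Signal d) :
    inner ℂ ψ (funOpConv f S ψ) = ((∫ z, f z * energy v ψ z : ℝ) : ℂ) := by
  have hi : Integrable (fun z : Phase d =>
      (f z : ℂ) • (tfShift z ∘L S ∘L ContinuousLinearMap.adjoint (tfShift z))) volume := by
    refine hf.ofReal (𝕜 := ℂ) |>.smul_bdd ‖S‖ (continuous_conjugate hv hS).aestronglyMeasurable
      (Filter.Eventually.of_forall fun z => ?_)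
    have hz : ‖tfShift (d := d) z‖ ≤ 1 := (tfShiftIsometry z).norm_toContinuousLinearMap_le
    calc _ ≤ ‖tfShift z‖ * (‖S‖ * ‖ContinuousLinearMap.adjoint (tfShift (d := d) z)‖) :=
          (ContinuousLinearMap.opNorm_comp_le _ _).trans
            (by gcongr; exact ContinuousLinearMap.opNorm_comp_le _ _)
      _ ≤ 1 * (‖S‖ * 1) := by
          gcongr
          rw [LinearIsometryEquiv.norm_map]
          exact hz
      _ = ‖S‖ := by ring
  rw [funOpConv, ContinuousLinearMap.integral_apply hi, ← integral_inner
    (hi.apply_continuousLinearMap ψ), ← integral_complex_ofReal]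
  refine integral_congr_ae (Filter.Eventually.of_forall fun z => ?_)
  simp only [smul_apply, inner_smul_right]
  rw [inner_conjugate_eq_energy hv hS]
  push_cast; rfl

/-- Quadratic form of the localization operator `A_f^g`. -/
theorem inner_locOp {f : Phase d → ℝ} (hf : Integrable f volume) (g ψ : Signal d) :
    inner ℂ ψ (locOp f g ψ) = ((∫ z, f z * ‖stft g ψ z‖ ^ 2 : ℝ) : ℂ) := by
  have hc : Continuous fun z => stft g ψ z • tfShift z g := by
    simp only [← inner_tfShift_left]
    exact ((continuous_tfShift g).inner (𝕜 := ℂ) continuous_const).smul (continuous_tfShift g)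
  have hi : Integrable (fun z : Phase d => ((f z : ℂ) * stft g ψ z) • tfShift z g) volume := by
    simp only [mul_smul]
    refine hf.ofReal (𝕜 := ℂ) |>.smul_bdd (‖g‖ * ‖ψ‖ * ‖g‖) hc.aestronglyMeasurable
      (Filter.Eventually.of_forall fun z => ?_)
    rw [norm_smul, norm_tfShift, ← inner_tfShift_left]
    gcongr
    exact norm_inner_tfShift_le g ψ z
  rw [locOp, ← integral_inner hi, ← integral_complex_ofReal]
  refine integral_congr_ae (Filter.Eventually.of_forall fun z => ?_)
  simp only [inner_smul_right]
  rw [← inner_conj_symm ψ, inner_tfShift_left, mul_assoc, Complex.mul_conj']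
  push_cast; rfl

end Energy

/-! ### Convolution with a probability density -/

section Convolution

variable {f K : Phase d → ℝ}

theorem integrable_mul_translate (hf : Integrable f volume) (hKc : Continuous K)
    (hK0 : ∀ z, 0 ≤ K z) (hK1 : ∀ z, K z ≤ 1) (z : Phase d) :
    Integrable (fun y => f y * K (z - y)) volume :=
  hf.mul_bdd (c := 1) (hKc.comp (by fun_prop)).aestronglyMeasurable
    (Filter.Eventually.of_forall fun y => by
      rw [Real.norm_of_nonneg (hK0 _)]; exact hK1 _)

/-- Convolution with a probability density moves a function of bounded variation in `L¹` at most
by the variation times the first moment of the density. -/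
theorem lintegral_enorm_convolution_sub_le (hf : Integrable f volume) (hvar : variation f < ∞)
    (hKc : Continuous K) (hK0 : ∀ z, 0 ≤ K z) (hK1 : ∀ z, K z ≤ 1)
    (hKint : ∫⁻ z, ENNReal.ofReal (K z) = 1) :
    ∫⁻ z, ‖(∫ y, f y * K (z - y)) - f z‖ₑ
      ≤ variation f * ∫⁻ z, ‖z‖ₑ * ENNReal.ofReal (K z) := by
  have hKi : Integrable K volume := by
    refine ⟨hKc.aestronglyMeasurable, ?_⟩
    rw [hasFiniteIntegral_iff_ofReal (Filter.Eventually.of_forall hK0), hKint]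
    exact ENNReal.one_lt_top
  have hK1' : ∫ y, K y = 1 := by
    rw [integral_eq_lintegral_of_nonneg_ae (Filter.Eventually.of_forall hK0)
      hKc.aestronglyMeasurable, hKint, ENNReal.toReal_one]
  have hpt : ∀ z, ‖(∫ y, f y * K (z - y)) - f z‖ₑ
      ≤ ∫⁻ y, ‖f (z - y) - f z‖ₑ * ENNReal.ofReal (K y) := fun z => by
    have hi := integrable_mul_translate hf hKc hK0 hK1 z
    have hi' : Integrable (fun y => f (z - y) * K y) volume := by
      simpa using hi.comp_sub_left z
    have e1 : ∫ y, f y * K (z - y) = ∫ y, f (z - y) * K y := by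
      have := integral_sub_left_eq_self (fun y => f y * K (z - y)) volume z
      simpa using this.symm
    -- Mass one lets `f z` be absorbed into the integral.
    have e2 : f z = ∫ y, f z * K y := by rw [integral_const_mul, hK1', mul_one]
    have e3 : (∫ y, f y * K (z - y)) - f z = ∫ y, (f (z - y) - f z) * K y := by
      rw [e1]
      conv_lhs => rw [e2]
      rw [← integral_sub hi' (hKi.const_mul _)]
      simp only [sub_mul]
    rw [e3]
    refine (enorm_integral_le_lintegral_enorm _).trans_eq (lintegral_congr fun y => ?_)
    rw [enorm_mul, Real.enorm_of_nonneg (hK0 y)]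
  have hmeas : AEMeasurable (Function.uncurry fun z y : Phase d =>
      ‖f (z - y) - f z‖ₑ * ENNReal.ofReal (K y)) (volume.prod volume) := by
    have h1 : AEStronglyMeasurable (fun p : Phase d × Phase d => f (p.1 - p.2))
        (volume.prod volume) :=
      hf.1.comp_quasiMeasurePreserving (quasiMeasurePreserving_sub_of_right_invariant _ _)
    have h2 : AEStronglyMeasurable (fun p : Phase d × Phase d => f p.1) (volume.prod volume) :=
      hf.1.comp_fst
    exact (h1.sub h2).enorm.mul (hKc.measurable.comp measurable_snd).ennreal_ofReal.aemeasurable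
  calc ∫⁻ z, ‖(∫ y, f y * K (z - y)) - f z‖ₑ
      ≤ ∫⁻ z, ∫⁻ y, ‖f (z - y) - f z‖ₑ * ENNReal.ofReal (K y) := lintegral_mono hpt
    _ = ∫⁻ y, ∫⁻ z, ‖f (z - y) - f z‖ₑ * ENNReal.ofReal (K y) := lintegral_lintegral_swap hmeas
    _ = ∫⁻ y, (∫⁻ z, ‖f (z - y) - f z‖ₑ) * ENNReal.ofReal (K y) := by
        refine lintegral_congr fun y => ?_
        rw [lintegral_mul_const' _ _ ENNReal.ofReal_ne_top]
    _ ≤ ∫⁻ y, variation f * (‖y‖ₑ * ENNReal.ofReal (K y)) := by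
        refine lintegral_mono fun y => ?_
        rw [← mul_assoc, mul_comm (variation f)]
        gcongr
        exact lintegral_enorm_translate_sub_le hf hvar y
    _ = variation f * ∫⁻ z, ‖z‖ₑ * ENNReal.ofReal (K z) := by
        rw [lintegral_const_mul' _ _ hvar.ne]

end Convolution

/-! ### The blurring kernel, the series identity and the error bound -/

section Families

variable {ι κ : Type*} {u : ι → Signal d} {v : κ → Signal d}

/-- The blurring kernel `∑_{i,j} |⟨π(z) v_j, u_i⟩|²` of two families. -/
def blurKernel (u : ι → Signal d) (v : κ → Signal d) (z : Phase d) : ℝ :=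
  ∑' i, energy v (u i) z

theorem blurKernel_nonneg (z : Phase d) : 0 ≤ blurKernel u v z :=
  tsum_nonneg fun _ => energy_nonneg _ _

theorem hasSum_blurKernel (hu : Summable fun i => ‖u i‖ ^ 2)
    (hv : HasSum (fun j => ‖v j‖ ^ 2) 1) (z : Phase d) :
    HasSum (fun i => energy v (u i) z) (blurKernel u v z) :=
  (Summable.of_nonneg_of_le (fun _ => energy_nonneg _ _) (fun i => energy_le hv (u i) z) hu).hasSum

theorem blurKernel_le_one (hu : HasSum (fun i => ‖u i‖ ^ 2) 1)
    (hv : HasSum (fun j => ‖v j‖ ^ 2) 1) (z : Phase d) : blurKernel u v z ≤ 1 :=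
  hasSum_le (fun i => energy_le hv (u i) z) (hasSum_blurKernel hu.summable hv z) hu

theorem continuous_blurKernel (hu : Summable fun i => ‖u i‖ ^ 2)
    (hv : HasSum (fun j => ‖v j‖ ^ 2) 1) : Continuous (blurKernel u v) := by
  refine continuous_tsum (fun i => continuous_energy hv.summable (u i)) hu fun i z => ?_
  rw [Real.norm_of_nonneg (energy_nonneg _ _)]
  exact energy_le hv _ _

theorem lintegral_blurKernel [Countable ι] [Countable κ] (hu : HasSum (fun i => ‖u i‖ ^ 2) 1)
    (hv : HasSum (fun j => ‖v j‖ ^ 2) 1) :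
    ∫⁻ z, ENNReal.ofReal (blurKernel u v z) = 1 := by
  have h1 : ∀ z, ENNReal.ofReal (blurKernel u v z)
      = ∑' i, ENNReal.ofReal (energy v (u i) z) := fun z => by
    rw [blurKernel, ENNReal.ofReal_tsum_of_nonneg (fun _ => energy_nonneg _ _)
      (hasSum_blurKernel hu.summable hv z).summable]
  simp only [h1]
  rw [lintegral_tsum fun i =>
    (continuous_energy hv.summable (u i)).measurable.ennreal_ofReal.aemeasurable]
  simp only [lintegral_energy hv]
  have : ∀ i, ‖u i‖ₑ ^ 2 = ENNReal.ofReal (‖u i‖ ^ 2) := fun i => by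
    rw [ENNReal.ofReal_pow (norm_nonneg _), ofReal_norm]
  simp only [this]
  rw [← ENNReal.ofReal_tsum_of_nonneg (fun _ => by positivity) hu.summable, hu.tsum_eq,
    ENNReal.ofReal_one]

/-- Covariance identifies both sides as sums of `|⟨π(z - y) v_j, u_i⟩|²`; nonnegative double sums
may be reordered. -/
theorem hasSum_energy_tfShift (hu : HasSum (fun i => ‖u i‖ ^ 2) 1)
    (hv : HasSum (fun j => ‖v j‖ ^ 2) 1) (z y : Phase d) :
    HasSum (fun j => energy u (tfShift z (v j)) y) (blurKernel u v (z - y)) := by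
  set a : ι → κ → ℝ := fun i j => ‖inner ℂ (tfShift (z - y) (v j)) (u i)‖ ^ 2 with ha
  have hrow : ∀ i, HasSum (fun j => a i j) (energy v (u i) (z - y)) := fun i =>
    hasSum_energy hv.summable _ _
  have hs : Summable (Function.uncurry a) := by
    refine (summable_prod_of_nonneg fun p => by simp only [Function.uncurry, ha]; positivity).2
      ⟨fun i => (hrow i).summable, ?_⟩
    have := (hasSum_blurKernel hu.summable hv (z - y)).summable
    simpa only [Function.uncurry, fun i => (hrow i).tsum_eq] using this
  have htot : HasSum (Function.uncurry a) (blurKernel u v (z - y)) := by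
    have h := hs.hasSum.prod_fiberwise hrow
    rw [(hasSum_blurKernel hu.summable hv (z - y)).unique h]
    exact hs.hasSum
  have hsw : HasSum (fun p : κ × ι => a p.2 p.1) (blurKernel u v (z - y)) :=
    (Equiv.prodComm κ ι).hasSum_iff.2 htot
  refine hsw.prod_fiberwise fun j => ?_
  have h := hasSum_energy hu.summable (tfShift z (v j)) y
  refine h.congr_fun ?_
  intro i
  simp only [ha]
  rw [← norm_inner_tfShift_tfShift, norm_inner_symm]

/-- Summing the energies of the images of a family under an operator with quadratic form
`ψ ↦ ∫ f · energy u ψ` gives a convolution with the blurring kernel. -/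
theorem hasSum_integral_mul_energy [Countable κ] {f : Phase d → ℝ} (hf : Integrable f volume)
    (hu : HasSum (fun i => ‖u i‖ ^ 2) 1) (hv : HasSum (fun j => ‖v j‖ ^ 2) 1) (z : Phase d) :
    HasSum (fun j => ∫ y, f y * energy u (tfShift z (v j)) y)
      (∫ y, f y * blurKernel u v (z - y)) := by
  have hle : ∀ j y, energy u (tfShift z (v j)) y ≤ ‖v j‖ ^ 2 := fun j y => by
    simpa only [norm_tfShift] using energy_le hu (tfShift z (v j)) y
  have hi : ∀ j, Integrable (fun y => f y * energy u (tfShift z (v j)) y) volume := fun j =>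
    hf.mul_bdd (c := ‖v j‖ ^ 2) (continuous_energy hu.summable _).aestronglyMeasurable
      (Filter.Eventually.of_forall fun y => by
        rw [Real.norm_of_nonneg (energy_nonneg _ _)]; exact hle j y)
  -- The `j`-th term has `L¹` norm at most `‖f‖₁ ‖v_j‖²`, which is summable.
  have h := hasSum_integral_of_summable_integral_norm hi (by
    refine Summable.of_nonneg_of_le (fun j => integral_nonneg fun _ => norm_nonneg _) (fun j => ?_)
      (hv.summable.mul_left (∫ y, ‖f y‖))
    rw [← integral_mul_const]
    refine integral_mono (hi j).norm (hf.norm.mul_const _) fun y => ?_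
    simp only [norm_mul]
    rw [Real.norm_of_nonneg (energy_nonneg (v := u) (tfShift z (v j)) y)]
    gcongr
    exact hle j y)
  have e : ∀ y, ∑' j, f y * energy u (tfShift z (v j)) y = f y * blurKernel u v (z - y) :=
    fun y => ((hasSum_energy_tfShift hu hv z y).mul_left (f y)).tsum_eq
  simpa only [e] using h

variable {f : Phase d → ℝ} {A : Signal d → Signal d} {lam : ℕ → ℝ} {h : ℕ → Signal d}

theorem hasSum_mul_norm_inner_sq (hA : IsSpectralDecomp A lam h) (w : Signal d) :
    HasSum (fun m => ((lam m * ‖inner ℂ w (h m)‖ ^ 2 : ℝ) : ℂ)) (inner ℂ w (A w)) := by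
  have hs := hasSum_inner_right (hA.2 w) w
  refine hs.congr_fun ?_
  intro m
  rw [InnerProductSpace.rankOne_apply, inner_smul_right, inner_smul_right,
    ← inner_conj_symm (h m) w, Complex.conj_mul']
  push_cast; rfl

/-- Orthonormality gives `λ_m = ⟨h_m, A h_m⟩`, and the energy of a unit vector is at most one. This
uniform bound suffices for absolute convergence of the double series below. -/
theorem abs_eigenvalue_le (hf : Integrable f volume) (hu : HasSum (fun i => ‖u i‖ ^ 2) 1)
    (hAf : ∀ ψ, inner ℂ ψ (A ψ) = ((∫ y, f y * energy u ψ y : ℝ) : ℂ))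
    (hA : IsSpectralDecomp A lam h) (m : ℕ) : |lam m| ≤ ∫ y, ‖f y‖ := by
  have h1 : ‖h m‖ = 1 := hA.1.1 m
  have hs := hasSum_mul_norm_inner_sq hA (h m)
  have hlam : (lam m : ℂ) = inner ℂ (h m) (A (h m)) := by
    have hsing : HasSum (fun k => ((lam k * ‖inner ℂ (h m) (h k)‖ ^ 2 : ℝ) : ℂ)) (lam m : ℂ) := by
      convert hasSum_single m fun k hk => ?_ using 1
      · rw [inner_self_eq_norm_sq_to_K, h1]; simp
      · rw [hA.1.2 hk.symm]; simp
    exact hsing.unique hs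
  rw [hAf] at hlam
  rw [Complex.ofReal_inj.1 hlam]
  refine (norm_integral_le_integral_norm fun y => f y * energy u (h m) y).trans ?_
  have hle : ∀ y, energy u (h m) y ≤ 1 := fun y => by
    simpa [h1] using energy_le hu (h m) y
  refine integral_mono_of_nonneg (Filter.Eventually.of_forall fun _ => norm_nonneg _) hf.norm
    (Filter.Eventually.of_forall fun y => ?_)
  simp only [norm_mul]
  rw [Real.norm_of_nonneg (energy_nonneg _ _)]
  exact mul_le_of_le_one_right (norm_nonneg _) (hle y)

/-- The Cohen's class distributions of the eigenfunctions, weighted by the eigenvalues, add up to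
the symbol blurred by the kernel. -/
theorem hasSum_eigenvalue_mul_energy [Countable κ] (hf : Integrable f volume)
    (hu : HasSum (fun i => ‖u i‖ ^ 2) 1) (hv : HasSum (fun j => ‖v j‖ ^ 2) 1)
    (hAf : ∀ ψ, inner ℂ ψ (A ψ) = ((∫ y, f y * energy u ψ y : ℝ) : ℂ))
    (hA : IsSpectralDecomp A lam h) (z : Phase d) :
    HasSum (fun m => lam m * energy v (h m) z) (∫ y, f y * blurKernel u v (z - y)) := by
  -- Summing over `m` first gives `⟨w, A w⟩` at `w = π(z) v_j`; over `j` first, the weighted energy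
  -- of `h_m`.
  set a : κ × ℕ → ℝ := fun p => lam p.2 * ‖inner ℂ (tfShift z (v p.1)) (h p.2)‖ ^ 2 with ha
  have hrow : ∀ j, HasSum (fun m => a (j, m)) (∫ y, f y * energy u (tfShift z (v j)) y) :=
    fun j => by
      have := hasSum_mul_norm_inner_sq hA (tfShift z (v j))
      rw [hAf] at this
      exact Complex.hasSum_ofReal.1 this
  -- Bounded eigenvalues and Bessel's inequality bound the `j`-th row by `C ‖v_j‖²`.
  have hs : Summable a := by
    set C := ∫ y, ‖f y‖
    have hC : 0 ≤ C := integral_nonneg fun _ => norm_nonneg _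
    have hb : ∀ j, Summable fun m => ‖inner ℂ (h m) (tfShift z (v j))‖ ^ 2 := fun j =>
      hA.1.inner_products_summable _
    have hbl : ∀ j, ∑' m, ‖inner ℂ (h m) (tfShift z (v j))‖ ^ 2 ≤ ‖v j‖ ^ 2 := fun j => by
      simpa only [norm_tfShift] using hA.1.tsum_inner_products_le (tfShift z (v j))
    have hc : Summable fun p : κ × ℕ => C * ‖inner ℂ (h p.2) (tfShift z (v p.1))‖ ^ 2 := by
      refine (summable_prod_of_nonneg fun p => by positivity).2
        ⟨fun j => (hb j).mul_left C, ?_⟩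
      refine Summable.of_nonneg_of_le (fun j => tsum_nonneg fun m => by positivity) (fun j => ?_)
        (hv.summable.mul_left C)
      rw [tsum_mul_left]
      gcongr
      exact hbl j
    refine Summable.of_norm_bounded hc fun p => ?_
    simp only [ha]
    rw [norm_mul, norm_inner_symm, Real.norm_of_nonneg (sq_nonneg (‖_‖ : ℝ))]
    gcongr
    exact abs_eigenvalue_le hf hu hAf hA p.2
  have htot : HasSum a (∫ y, f y * blurKernel u v (z - y)) := by
    rw [(hasSum_integral_mul_energy hf hu hv z).unique (hs.hasSum.prod_fiberwise hrow)]
    exact hs.hasSum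
  have hsw : HasSum (fun p : ℕ × κ => a p.swap) (∫ y, f y * blurKernel u v (z - y)) :=
    (Equiv.prodComm ℕ κ).hasSum_iff.2 htot
  exact hsw.prod_fiberwise fun m => (hasSum_energy hv.summable (h m) z).mul_left (lam m)

/-- Each energy of `h_m` integrates to `‖h_m‖² = 1`. The values lie in `[0, ∞]`, so no summability
of the eigenvalues is required. -/
theorem lintegral_enorm_tsum_le [Countable κ] (hv : HasSum (fun j => ‖v j‖ ^ 2) 1)
    (hh : Orthonormal ℂ h) (N : ℕ) :
    ∫⁻ z, ‖∑' m, lam (m + N) * energy v (h (m + N)) z‖ₑ ≤ ∑' m, ‖lam (N + m)‖ₑ := by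
  calc ∫⁻ z, ‖∑' m, lam (m + N) * energy v (h (m + N)) z‖ₑ
      ≤ ∫⁻ z, ∑' m, ‖lam (N + m)‖ₑ * ENNReal.ofReal (energy v (h (N + m)) z) := by
        refine lintegral_mono fun z => enorm_tsum_le_tsum_enorm.trans_eq (tsum_congr fun m => ?_)
        rw [enorm_mul, Real.enorm_of_nonneg (energy_nonneg _ _), add_comm]
    _ = ∑' m, ‖lam (N + m)‖ₑ := by
        rw [lintegral_tsum fun m => (((continuous_energy hv.summable
          (h (N + m))).measurable.ennreal_ofReal).const_mul _).aemeasurable]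
        refine tsum_congr fun m => ?_
        rw [lintegral_const_mul' _ _ enorm_ne_top, lintegral_energy hv, ← ofReal_norm (h (N + m)), hh.1]
        simp

/-- Reconstruction of the symbol from finitely many eigenfunctions. -/
theorem lintegral_enorm_partial_sum_sub_le [Countable ι] [Countable κ] (hf : Integrable f volume)
    (hvar : variation f < ∞)
    (hu : HasSum (fun i => ‖u i‖ ^ 2) 1) (hv : HasSum (fun j => ‖v j‖ ^ 2) 1)
    (hAf : ∀ ψ, inner ℂ ψ (A ψ) = ((∫ y, f y * energy u ψ y : ℝ) : ℂ))
    (hA : IsSpectralDecomp A lam h) (N : ℕ) :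
    ∫⁻ z, ‖(∑ m ∈ Finset.range N, lam m * energy v (h m) z) - f z‖ₑ ≤
      variation f * (∫⁻ z, ‖z‖ₑ * ENNReal.ofReal (blurKernel u v z)) +
        ∑' m, ‖lam (N + m)‖ₑ := by
  have hpt : ∀ z, ‖(∑ m ∈ Finset.range N, lam m * energy v (h m) z) - f z‖ₑ ≤
      ‖(∫ y, f y * blurKernel u v (z - y)) - f z‖ₑ +
        ‖∑' m, lam (m + N) * energy v (h (m + N)) z‖ₑ := fun z => by
    have hs := hasSum_eigenvalue_mul_energy hf hu hv hAf hA z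
    have e : (∑ m ∈ Finset.range N, lam m * energy v (h m) z) - f z
        = ((∫ y, f y * blurKernel u v (z - y)) - f z)
          - ∑' m, lam (m + N) * energy v (h (m + N)) z := by
      rw [← hs.tsum_eq, ← hs.summable.sum_add_tsum_nat_add N]
      ring
    rw [e]
    exact enorm_sub_le
  have hm : AEMeasurable (fun z => ‖∑' m, lam (m + N) * energy v (h (m + N)) z‖ₑ) volume := by
    have hc : ∀ m, Measurable fun z => lam m * energy v (h m) z := fun m =>
      (continuous_energy hv.summable (h m)).measurable.const_mul _
    exact (Measurable.enorm (Measurable.tsum fun m => hc (m + N))).aemeasurable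
  refine (lintegral_mono hpt).trans ?_
  rw [lintegral_add_right' _ hm]
  exact add_le_add (lintegral_enorm_convolution_sub_le hf hvar (continuous_blurKernel hu.summable hv)
    blurKernel_nonneg (blurKernel_le_one hu hv) (lintegral_blurKernel hu hv))
    (lintegral_enorm_tsum_le hv hA.1 N)

end Families

end LocOp

end

/-! ### Assembly of both cases -/

theorem theorem2 (d : ℕ) (f : LocOp.Phase d → ℝ) (hf : Integrable f volume)
    (hvar : LocOp.variation f < ∞) :
    -- mixed-state localization operators
    (∀ S T : LocOp.Signal d →L[ℂ] LocOp.Signal d,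
      S.IsPositive → LocOp.IsTraceClass S → LocOp.opTrace S = 1 →
      T.IsPositive → LocOp.IsTraceClass T → LocOp.opTrace T = 1 →
      ∀ (lam : ℕ → ℝ) (h : ℕ → LocOp.Signal d),
        LocOp.IsSpectralDecomp (LocOp.funOpConv f S) lam h →
        -- the blurring kernel is a non-negative function whose convolution with `f` exists
        (∀ z, 0 ≤ LocOp.opOpConv S (LocOp.check T) z) ∧
        ConvolutionExists f (LocOp.opOpConv S (LocOp.check T))
          (ContinuousLinearMap.lsmul ℝ ℝ) volume ∧
        (∀ z, HasSum (fun m => (lam m : ℂ) * LocOp.cohen T (h m) z)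
          ((f ⋆[ContinuousLinearMap.lsmul ℝ ℝ, volume]
            LocOp.opOpConv S (LocOp.check T)) z)) ∧
        ∀ N : ℕ,
          eLpNorm (fun z => (∑ m ∈ Finset.range N, (lam m : ℂ) * LocOp.cohen T (h m) z) - (f z : ℂ))
              1 volume ≤
            LocOp.variation f *
                (∫⁻ z, ‖z‖ₑ * ENNReal.ofReal (LocOp.opOpConv S (LocOp.check T) z).re) +
              ∑' m : ℕ, ‖lam (N + m)‖ₑ) ∧
    -- the rank-one case
    (∀ g φ : LocOp.Signal d, ‖g‖ = 1 → ‖φ‖ = 1 →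
      ∀ (lam : ℕ → ℝ) (h : ℕ → LocOp.Signal d),
        LocOp.IsSpectralDecomp (LocOp.locOp f g) lam h →
        ∀ N : ℕ,
          eLpNorm (fun z => (∑ m ∈ Finset.range N, lam m * ‖LocOp.stft φ (h m) z‖ ^ 2) - f z)
              1 volume ≤
            LocOp.variation f * (∫⁻ z, ‖z‖ₑ * ‖LocOp.stft φ g z‖ₑ ^ 2) +
              ∑' m : ℕ, ‖lam (N + m)‖ₑ) := by
  refine ⟨fun S T hS _ hS1 hT _ hT1 lam h hA => ?_, fun g φ hg hφ lam h hA N => ?_⟩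
  · obtain ⟨s, u, _, hu, hSu⟩ := LocOp.exists_hasSum_rankOne hS hS1
    obtain ⟨t, v, _, hv, hTv⟩ := LocOp.exists_hasSum_rankOne hT hT1
    have hK : LocOp.opOpConv S (LocOp.check T) = fun z => (LocOp.blurKernel u v z : ℂ) :=
      funext fun z => LocOp.opOpConv_eq_tsum_energy hu.summable hv.summable hSu hTv z
    have hQ : ∀ ψ z, LocOp.cohen T ψ z = (LocOp.energy v ψ z : ℂ) :=
      LocOp.cohen_eq_energy hv.summable hTv
    have hAf := LocOp.inner_funOpConv hf hu.summable hSu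
    have hKc := LocOp.continuous_blurKernel hu.summable hv
    simp only [hK, hQ]
    refine ⟨fun z => ?_, fun z => ?_, fun z => ?_, fun N => ?_⟩
    · exact Complex.zero_le_real.2 (LocOp.blurKernel_nonneg z)
    · have hi := (LocOp.integrable_mul_translate hf hKc LocOp.blurKernel_nonneg
        (LocOp.blurKernel_le_one hu hv) z).ofReal (𝕜 := ℂ)
      refine hi.congr (Filter.Eventually.of_forall fun y => ?_)
      simp
    · have hs := Complex.hasSum_ofReal.2
        (LocOp.hasSum_eigenvalue_mul_energy hf hu hv hAf hA z)
      rw [← integral_complex_ofReal] at hs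
      simpa [convolution] using hs
    · have hb := LocOp.lintegral_enorm_partial_sum_sub_le hf hvar hu hv hAf hA N
      rw [eLpNorm_one_eq_lintegral_enorm]
      simp only [Complex.ofReal_re]
      refine (lintegral_congr fun z => ?_).trans_le hb
      rw [← ofReal_norm, ← ofReal_norm, ← Complex.norm_real]
      push_cast; rfl
  -- One-element families `g` and `φ`: the energies become squared short-time Fourier transforms and
  -- the kernel becomes `|V_φ g|²`.
  · have hu : HasSum (fun _ : Unit => ‖g‖ ^ 2) 1 := by
      simp [hg]
    have hv : HasSum (fun _ : Unit => ‖φ‖ ^ 2) 1 := by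
      simp [hφ]
    have hE : ∀ (γ ψ : LocOp.Signal d) z,
        LocOp.energy (fun _ : Unit => γ) ψ z = ‖LocOp.stft γ ψ z‖ ^ 2 := fun γ ψ z => by
      simp [LocOp.energy, LocOp.inner_tfShift_left]
    have hAf : ∀ ψ, inner ℂ ψ (LocOp.locOp f g ψ)
        = ((∫ y, f y * LocOp.energy (fun _ : Unit => g) ψ y : ℝ) : ℂ) := fun ψ => by
      simp only [hE]
      exact LocOp.inner_locOp hf g ψ
    have hb := LocOp.lintegral_enorm_partial_sum_sub_le hf hvar hu hv hAf hA N
    rw [eLpNorm_one_eq_lintegral_enorm]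
    simp only [hE, LocOp.blurKernel, tsum_fintype, Finset.univ_unique, Finset.sum_singleton,
      ENNReal.ofReal_pow (norm_nonneg _), ofReal_norm] at hb
    exact hb
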